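/- For integers $\ell,s,t\ge 2$, the double broom $B(\ell,s,t)$ is the tree obtained from a path $P_\ell$ on $\ell$ vertices by attaching $s$ pendant edges to one end vertex of $P_\ell$ and $t$ pendant edges to the other end vertex. For a graph $F$ and an integer $p\ge 2$, the edge blow-up $F^{p+1}$ is the graph obtained from $F$ by replacing each edge of $F$ by a clique of size $p+1$, where the new vertices of the cliques are all distinct. Let $\mathrm{ex}(n,F)$ be the maximum number of edges of a graph on $n$ vertices that does not contain $F$ as a (not necessarily induced) subgraph; an $F$-free graph on $n$ vertices with $\mathrm{ex}(n,F)$ edges is called extremal for $F$. Let $T(m,p)$ be the $p$-partite Turán graph on $m$ vertices (the complete $p$-partite graph whose class sizes differ by at most one), let $H(n,p,q)=K_{q-1}+T(n-q+1,p)$ be the join of the complete graph on $q-1$ vertices and $T(n-q+1,p)$, and let $h(n,p,q)$ be its number of edges. Let $p\ge 3$ and $k,s,t\ge 2$ be integers, and let $T=B(2k,s,t)$. Then there is an $N=N(p,k,s,t)$ such that for all $n\ge N$ $$\mathrm{ex}(n,T^{p+1})=h(n,p,k+1),$$ and $H(n,p,k+1)$ is, up to isomorphism, the unique extremal graph on $n$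 vertices for $T^{p+1}$. -/

import Mathlib

namespace EdgeBlowup

open SimpleGraph

/-- The join `G + H`: the disjoint union of `G` and `H` together with all edges between the two
vertex sets. -/
def join {V W : Type*} (G : SimpleGraph V) (H : SimpleGraph W) : SimpleGraph (V ⊕ W) :=
  (G ⊕g H) ⊔ completeBipartiteGraph V W

/-- The vertex set of the clique that replaces the edge `e` of `H`: the two ends of `e` and the
`m - 2` new vertices that belong to `e`. -/
def edgeClique {V : Type*} (H : SimpleGraph V) (m : ℕ) (e : H.edgeSet) :
    Set (V ⊕ H.edgeSet × Fin (m - 2)) :=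
  {x | Sum.elim (fun v => v ∈ (e : Sym2 V)) (fun a => a.1 = e) x}

/-- The edge blow-up `H^m`: each edge of `H` is replaced by a clique of size `m`, the new vertices
of the cliques being all distinct. (The blow-up `H^{p+1}` is the case `m = p + 1`.) -/
def edgeBlowup {V : Type*} (H : SimpleGraph V) (m : ℕ) :
    SimpleGraph (V ⊕ H.edgeSet × Fin (m - 2)) :=
  SimpleGraph.fromRel fun x y =>
    ∃ e : H.edgeSet, x ∈ edgeClique H m e ∧ y ∈ edgeClique H m e

/-- The double broom `B(ℓ, s, t)`: a path on the vertices `Fin ℓ`, with `s` pendant edges attached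
to its first vertex and `t` pendant edges attached to its last vertex. -/
def doubleBroom (ℓ s t : ℕ) : SimpleGraph (Fin ℓ ⊕ (Fin s ⊕ Fin t)) :=
  SimpleGraph.fromRel fun x y =>
    match x, y with
    | .inl i, .inl j => (pathGraph ℓ).Adj i j
    | .inl i, .inr (.inl _) => i.val = 0
    | .inl i, .inr (.inr _) => i.val + 1 = ℓ
    | .inr _, _ => False

/-- The graph `H(n, p, q) = K_{q-1} + T(n-q+1, p)`, where `T(m, p)` is the `p`-partite Turán graph
on `m` vertices; it has `n` vertices as soon as `q - 1 ≤ n`. -/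
def graphH (n p q : ℕ) : SimpleGraph (Fin (q - 1) ⊕ Fin (n - (q - 1))) :=
  join (completeGraph (Fin (q - 1))) (turanGraph (n - (q - 1)) p)

open Classical in
/-- `h(n, p, q) = e(H(n, p, q))`. -/
noncomputable def numH (n p q : ℕ) : ℕ :=
  (graphH n p q).edgeFinset.card

end EdgeBlowup

/-! Lower bound. The broom has `k + 1` disjoint edges, so its blow-up has `k + 1` disjoint cliques
of size `p + 1`. In `graphH n p (k + 1)` each such clique uses one of the `k` dominating vertices,
because the rest is `p`-partite; hence `graphH` is free (`edgeBlowup_free_graphH`).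

Upper bound. Only one feature of the broom matters: a `NearCover`, an independent set `S` of `k`
vertices that meets all edges but one, with few neighbours in `S` for each outside vertex. Let `G`
be free with at least `h(n)` edges. Deleting vertices of small degree raises the excess over `h`, so
for large `n` the minimum degree may be assumed to be at least `(1 - 1/p) n - C`
(`exists_forall_degree_of_induction`). The blow-up is `(p + 1)`-colourable, so `G` has no large
complete `(p + 1)`-partite subgraph. With the minimum-degree form of Erdős–Stone this yields `p`
balanced, almost completely joined classes `P i` covering almost all of `G` (`exists_core`).

Let `W` be the set of vertices with linearly many neighbours in every class; its size is bounded
(`exists_card_wide_le`). Every other vertex has a colour `i` with few neighbours in `P i`, hence is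
joined to almost all of the other classes. A matching of size `e(T)` inside one colour class would
give the blow-up, so those classes contain few edges. Counting degrees, `W` must contain `k`
vertices of degree well above `(1 - 1/p) n`, and these can play the role of `S`. A further vertex of
`W`, or an edge inside a colour class, could be put in the clique of the one uncovered edge and
would complete a copy. So `#W = k` and `G - W` is `p`-colourable (`exists_partition`). Turán's
theorem and its equality case then give `graphH` (`nonempty_iso_graphH`). -/

namespace EdgeBlowup

open SimpleGraph Finset

open scoped Classical

/-! ### Neighbourhood counts and complete multipartite families -/

/-- The neighbours of `x` that lie in `A`. -/
noncomputable def nb {V : Type} (G : SimpleGraph V) (x : V) (A : Finset V) : Finset V :=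
  {y ∈ A | G.Adj x y}

lemma mem_nb {V : Type} {G : SimpleGraph V} {x y : V} {A : Finset V} :
    y ∈ nb G x A ↔ y ∈ A ∧ G.Adj x y := by simp [nb]

lemma nb_subset {V : Type} (G : SimpleGraph V) (x : V) (A : Finset V) : nb G x A ⊆ A :=
  filter_subset _ _

lemma card_nb_univ {V : Type} [Fintype V] (G : SimpleGraph V) (x : V) :
    #(nb G x univ) = G.degree x := by
  rw [← card_neighborFinset_eq_degree, neighborFinset_eq_filter, nb]

lemma card_nb_add_card_not {V : Type} (G : SimpleGraph V) (x : V) (A : Finset V) :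
    #(nb G x A) + #{y ∈ A | ¬ G.Adj x y} = #A :=
  card_filter_add_card_filter_not _

lemma sum_card_nb_comm {V : Type} (G : SimpleGraph V) (X Y : Finset V) :
    ∑ x ∈ X, #(nb G x Y) = ∑ y ∈ Y, #(nb G y X) := by
  have := sum_card_bipartiteAbove_eq_sum_card_bipartiteBelow (s := X) (t := Y) G.Adj
  simpa [bipartiteAbove, bipartiteBelow, nb, G.adj_comm] using this

/-- A family of vertex sets with all edges present between any two of them. -/
def CompleteFamily {V ι : Type} (G : SimpleGraph V) (B : ι → Finset V) : Prop :=
  ∀ i j, i ≠ j → ∀ x ∈ B i, ∀ y ∈ B j, G.Adj x y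

/-- `G` has no complete `(p + 1)`-partite subgraph with all classes of size at least `m`. -/
def NoBlowup {V : Type} (G : SimpleGraph V) (p m : ℕ) : Prop :=
  ∀ B : Option (Fin p) → Finset V, CompleteFamily G B → ∃ i, #(B i) < m

/-- Each colour class is injected into the class of its colour. Images of different colours cannot
collide, since vertices of different classes are adjacent and `G` has no loops. -/
lemma isContained_of_completeFamily {U V ι : Type} [Fintype U] {F : SimpleGraph U}
    {G : SimpleGraph V} (c : F.Coloring ι) {B : ι → Finset V} (hB : CompleteFamily G B)
    (hcard : ∀ i, Fintype.card U ≤ #(B i)) : F ⊑ G := by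
  have h : ∀ i, Nonempty (U ↪ B i) := fun i => by
    rw [Function.Embedding.nonempty_iff_card_le, Fintype.card_coe]; exact hcard i
  have f := fun i => (h i).some
  refine ⟨⟨⟨fun u => (f (c u) u : V), ?_⟩, ?_⟩⟩
  · intro u v huv
    exact hB _ _ (c.valid huv) _ (f (c u) u).2 _ (f (c v) v).2
  · intro u v huv
    replace huv : (f (c u) u : V) = f (c v) v := huv
    by_cases h : c u = c v
    · have : (f (c v) u : V) = f (c v) v := by rw [← huv, h]
      exact (f (c v)).injective (Subtype.ext this)
    · have h1 := hB _ _ h _ (f (c u) u).2 _ (f (c v) v).2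
      exact absurd huv h1.ne

lemma exists_nat_mul_ge (c : ℝ) {ε : ℝ} (hε : 0 < ε) :
    ∃ N : ℕ, ∀ n : ℕ, N ≤ n → c ≤ ε * n := by
  obtain ⟨N, hN⟩ := exists_nat_ge (c / ε)
  refine ⟨N, fun n hn => ?_⟩
  rw [div_le_iff₀ hε] at hN
  have : (N : ℝ) ≤ n := by exact_mod_cast hn
  nlinarith

/-! ### From minimum degree to an almost complete balanced `p`-partite core -/

/-- Many vertices have a common trace on a small set. -/
lemma exists_same_nb {V : Type} (G : SimpleGraph V) (A B : Finset V) (t : ℕ)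
    (h : t * 2 ^ #B < #A) :
    ∃ Q ⊆ B, ∃ A' ⊆ A, t < #A' ∧ ∀ a ∈ A', nb G a B = Q := by
  have h1 : ∀ a ∈ A, nb G a B ∈ B.powerset := fun a _ => mem_powerset.2 (nb_subset _ _ _)
  obtain ⟨Q, hQ, hlt⟩ := exists_lt_card_fiber_of_mul_lt_card_of_maps_to h1
    (n := t) (by rw [card_powerset, mul_comm]; exact h)
  exact ⟨Q, mem_powerset.1 hQ, _, filter_subset _ _, hlt, fun a ha => (mem_filter.1 ha).2⟩

lemma card_biUnion_le_mul {V : Type} {p M : ℕ} (B : Fin p → Finset V) (hM : ∀ i, #(B i) ≤ M) :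
    #(univ.biUnion B) ≤ p * M := by
  refine card_biUnion_le.trans ?_
  calc ∑ i, #(B i) ≤ ∑ _i : Fin p, M := sum_le_sum fun i _ => hM i
    _ = p * M := by simp

/-- Otherwise, by pigeonhole over the traces on the union of the `B i`, more than `m` of these
vertices share a trace. That trace has `m` vertices in each `B i`, so together with them it forms a
forbidden complete `(p + 1)`-partite graph. -/
lemma card_fully_joined_le {V : Type} [Fintype V] {G : SimpleGraph V} {p m M : ℕ}
    {B : Fin p → Finset V} (hB : CompleteFamily G B) (hM : ∀ i, #(B i) ≤ M)
    (hfree : NoBlowup G p m) :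
    #{x : V | ∀ i, m ≤ #(nb G x (B i))} ≤ m * 2 ^ (p * M) := by
  by_contra! hlt
  obtain ⟨Q, hQ, A', hA', ht, hQA⟩ := exists_same_nb G _ (univ.biUnion B) m
    (lt_of_le_of_lt (Nat.mul_le_mul_left m (Nat.pow_le_pow_right (by norm_num)
      (card_biUnion_le_mul B hM))) hlt)
  have key : ∀ a ∈ A', ∀ i, nb G a (B i) = {y ∈ B i | y ∈ Q} := by
    intro a ha i
    ext y
    simp only [mem_nb, mem_filter, ← hQA a ha, mem_biUnion, mem_univ, true_and]
    constructor
    · rintro ⟨h1, h2⟩; exact ⟨h1, ⟨i, h1⟩, h2⟩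
    · rintro ⟨h1, -, h2⟩; exact ⟨h1, h2⟩
  obtain ⟨i, hi⟩ := hfree (fun o => o.elim A' fun i => {y ∈ B i | y ∈ Q}) (by
    have hadj : ∀ a ∈ A', ∀ i, ∀ y ∈ ({y ∈ B i | y ∈ Q} : Finset V), G.Adj a y := by
      intro a ha i y hy
      rw [← key a ha i] at hy
      exact (mem_nb.1 hy).2
    rintro (_ | i) (_ | j) hij x hx y hy
    · exact absurd rfl hij
    · exact hadj x hx j y hy
    · exact (hadj y hy i x hx).symm
    · exact hB i j (fun h => hij (by rw [h])) x (mem_filter.1 hx).1 y (mem_filter.1 hy).1)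
  rcases i with _ | i
  · simp at hi; omega
  · obtain ⟨a, ha⟩ : A'.Nonempty := card_pos.1 (by omega)
    have h2 := (mem_filter.1 (hA' ha)).2 i
    rw [key a ha i] at h2
    simp at hi; omega

lemma sum_add_le_of_le {p M : ℕ} {f : Fin p → ℕ} (hf : ∀ i, f i ≤ M) (i : Fin p) :
    ∑ j, f j + M ≤ f i + p * M := by
  have h1 := add_sum_erase univ f (mem_univ i)
  have h2 : ∑ j ∈ univ.erase i, f j ≤ #(univ.erase i) * M := by
    rw [← smul_eq_mul]; exact sum_le_card_nsmul _ _ _ fun j _ => hf j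
  rw [card_erase_of_mem (mem_univ i), card_univ, Fintype.card_fin] at h2
  have hp : 1 ≤ p := by have := i.2; omega
  obtain ⟨q, rfl⟩ := Nat.exists_eq_add_of_le hp
  simp only [Nat.add_sub_cancel_left] at h2
  nlinarith

lemma sum_add_two_mul_le_of_le {p M : ℕ} {f : Fin p → ℕ} (hf : ∀ i, f i ≤ M) {i j : Fin p}
    (hij : i ≠ j) : ∑ l, f l + 2 * M ≤ f i + f j + p * M := by
  -- Raising coordinate `j` to the maximal value `M` reduces the two-index bound to the one-index
  -- bound.
  have h := sum_add_le_of_le (f := Function.update f j M) (M := M) (fun l => by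
    by_cases h : l = j
    · subst h; simp
    · simp [h, hf]) i
  have h1 := add_sum_erase univ f (mem_univ j)
  have h2 := add_sum_erase univ (Function.update f j M) (mem_univ j)
  have h3 : ∑ l ∈ univ.erase j, Function.update f j M l = ∑ l ∈ univ.erase j, f l :=
    sum_congr rfl fun l hl => by simp [(mem_erase.1 hl).1]
  simp [hij] at h h2
  omega

lemma card_le_add_of_degree {V : Type} [Fintype V] (G : SimpleGraph V) (x : V) (A : Finset V) :
    #A + G.degree x ≤ #(nb G x A) + Fintype.card V := by
  have h1 := card_nb_add_card_not G x A
  have h2 := card_nb_add_card_not G x univ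
  have h3 : #{y ∈ A | ¬ G.Adj x y} ≤ #{y ∈ univ | ¬ G.Adj x y} :=
    card_le_card (filter_subset_filter _ (subset_univ _))
  rw [card_nb_univ, card_univ] at h2
  omega

/-- The vertices of `U i` have few neighbours in `B i`, and bounded subsets of `U i` have many
common neighbours in the other classes `B j`. -/
lemma exists_types_of_family {V : Type} [Fintype V] {G : SimpleGraph V} {p m M K : ℕ} {C : ℝ}
    {B : Fin p → Finset V} (hp : 0 < p) (hB : CompleteFamily G B) (hM : ∀ i, #(B i) = M)
    (hfree : NoBlowup G p m) (hMK : 2 * m * (K * m) + m ≤ M) (hm : 0 < m) (hMK' : m + K * m < M)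
    (hdeg : ∀ v, (1 - 1 / p : ℝ) * Fintype.card V - C ≤ G.degree v) :
    ∃ U : Fin p → Finset V, (∀ i j, i ≠ j → Disjoint (U i) (U j)) ∧
      (∀ i j, i ≠ j → ∀ S ⊆ U i, #S ≤ 2 * m → m ≤ #{b ∈ B j | ∀ x ∈ S, G.Adj x b}) ∧
      (∀ i, M * (#(U i) - (Fintype.card V : ℝ) / p - C) ≤ m * #(U i)) ∧
      ∃ a y : ℕ, a ≤ m * 2 ^ (p * M) ∧ Fintype.card V ≤ ∑ i, #(U i) + a + y ∧
        (y * (K * m) : ℝ) ≤ m * Fintype.card V + a * M + p * M * C := by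
  -- Trichotomy by the trace on the family: `A` is joined to a good part of every class; `Y` misses
  -- `m` of some class and has a total `d` falling clearly short of `(p - 1) M`; `U i` almost misses
  -- `B i` but is joined to nearly all of the rest.
  set A : Finset V := {x : V | ∀ i, m ≤ #(nb G x (B i))} with hA
  set d : V → ℕ := fun x => ∑ i, #(nb G x (B i)) with hd
  set Y : Finset V := {x : V | x ∉ A ∧ d x + K * m + M ≤ p * M + m} with hY
  set U : Fin p → Finset V := fun i => {x : V | x ∉ A ∧ x ∉ Y ∧ #(nb G x (B i)) < m} with hU
  have hnb : ∀ x i, #(nb G x (B i)) ≤ M := fun x i => by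
    rw [← hM i]; exact card_le_card (nb_subset _ _ _)
  have hUj : ∀ i j, i ≠ j → ∀ x ∈ U i, M < #(nb G x (B j)) + K * m := by
    intro i j hij x hx
    simp only [hU, mem_filter, mem_univ, true_and, hY] at hx
    obtain ⟨h1, h2, h3⟩ := hx
    have h4 : ¬ (d x + K * m + M ≤ p * M + m) := fun h => h2 ⟨h1, h⟩
    have h5 := sum_add_two_mul_le_of_le (hnb x) hij
    simp only [hd] at h4
    omega
  have hUi : ∀ i, ∀ x ∈ U i, #(nb G x (B i)) < m := by
    intro i x hx
    simp only [hU, mem_filter, mem_univ, true_and] at hx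
    exact hx.2.2
  refine ⟨U, ?_, ?_, ?_, #A, #Y, card_fully_joined_le hB (fun i => (hM i).le) hfree, ?_, ?_⟩
  · intro i j hij
    rw [Finset.disjoint_left]
    intro x hx hx'
    have h1 := hUj i j hij x hx
    have h2 := hUi j x hx'
    omega
  · intro i j hij S hS hcard
    have hsub : B j ⊆ {b ∈ B j | ∀ x ∈ S, G.Adj x b} ∪
        S.biUnion fun x => {b ∈ B j | ¬ G.Adj x b} := by
      intro b hb
      by_cases h : ∀ x ∈ S, G.Adj x b
      · exact mem_union_left _ (mem_filter.2 ⟨hb, h⟩)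
      · push Not at h
        obtain ⟨x, hx, hxb⟩ := h
        exact mem_union_right _ (mem_biUnion.2 ⟨x, hx, mem_filter.2 ⟨hb, hxb⟩⟩)
    have h1 := (card_le_card hsub).trans (card_union_le _ _)
    have h2 : #(S.biUnion fun x => {b ∈ B j | ¬ G.Adj x b}) ≤ #S * (K * m) := by
      refine card_biUnion_le_card_mul _ _ _ fun x hx => ?_
      have h3 := hUj i j hij x (hS hx)
      have h4 := card_nb_add_card_not G x (B j)
      rw [hM j] at h4
      omega
    have h3 : #S * (K * m) ≤ 2 * m * (K * m) := Nat.mul_le_mul_right _ hcard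
    rw [hM j] at h1
    omega
  · intro i
    -- Double counting between `U i` and `B i`: few edges seen from `U i`, while the minimum degree
    -- forces each vertex of `B i` to have at least `#(U i) - n/p - C` neighbours in `U i`.
    have h1 : ∑ x ∈ U i, #(nb G x (B i)) ≤ #(U i) * m := by
      rw [← smul_eq_mul]; exact sum_le_card_nsmul _ _ _ fun x hx => (hUi i x hx).le
    rw [sum_card_nb_comm] at h1
    have h2 : ∀ b ∈ B i, (#(U i) - (Fintype.card V : ℝ) / p - C) ≤ (#(nb G b (U i)) : ℝ) := by
      intro b _
      have h3 := card_le_add_of_degree G b (U i)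
      have h4 := hdeg b
      have h5 : (#(U i) : ℝ) + G.degree b ≤ #(nb G b (U i)) + Fintype.card V := by
        exact_mod_cast h3
      have : (1 - 1 / p : ℝ) * Fintype.card V = Fintype.card V - Fintype.card V / p := by ring
      linarith
    have h3 := card_nsmul_le_sum (B i) (fun b => (#(nb G b (U i)) : ℝ)) _ h2
    rw [hM i, nsmul_eq_mul] at h3
    have h1' : (∑ b ∈ B i, (#(nb G b (U i)) : ℝ)) ≤ #(U i) * m := by exact_mod_cast h1
    linarith
  · have hsub : (univ : Finset V) ⊆ univ.biUnion U ∪ A ∪ Y := by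
      intro x _
      by_cases h1 : x ∈ A
      · simp [h1]
      · by_cases h2 : x ∈ Y
        · simp [h2]
        · have h3 := h1
          simp only [hA, mem_filter, mem_univ, true_and, not_forall, not_le] at h3
          obtain ⟨i, hi⟩ := h3
          refine mem_union_left _ (mem_union_left _ (mem_biUnion.2 ⟨i, mem_univ _, ?_⟩))
          simp only [hU, mem_filter, mem_univ, true_and]
          exact ⟨h1, h2, hi⟩
    have h1 := card_le_card hsub
    have h2 := card_union_le (univ.biUnion U ∪ A) Y
    have h3 := card_union_le (univ.biUnion U) A
    have h4 : #(univ.biUnion U) ≤ ∑ i, #(U i) := card_biUnion_le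
    rw [card_univ] at h1
    omega
  -- A typical vertex has `d x` at most about `(p - 1) M`, `A` may gain `M`, and `Y` loses `K * m`.
  -- The sum of `d` is the degree sum over the family, which the minimum degree bounds below; so `Y`
  -- is small.
  · have hpt : ∀ x : V, d x + M + (if x ∈ Y then K * m else 0) ≤
        p * M + m + (if x ∈ A then M else 0) := by
      intro x
      by_cases h1 : x ∈ A
      · have h2 : x ∉ Y := by simp [hY, h1]
        have h3 := sum_add_le_of_le (hnb x) ⟨0, hp⟩
        have := hnb x ⟨0, hp⟩
        simp only [h1, h2, if_true, if_false, hd]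
        omega
      · by_cases h2 : x ∈ Y
        · have h3 := h2
          simp only [hY, mem_filter, mem_univ, true_and] at h3
          simp only [h1, h2, if_true, if_false]
          omega
        · have h3 := h1
          simp only [hA, mem_filter, mem_univ, true_and, not_forall, not_le] at h3
          obtain ⟨i, hi⟩ := h3
          have h4 := sum_add_le_of_le (hnb x) i
          simp only [h1, h2, if_false, hd]
          omega
    have hsum := sum_le_sum fun x (_ : x ∈ (univ : Finset V)) => hpt x
    simp only [sum_add_distrib, sum_ite_mem, univ_inter, sum_const, smul_eq_mul,
      card_univ] at hsum
    have hdsum : ∑ x, d x = ∑ i, ∑ b ∈ B i, G.degree b := by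
      simp only [hd]
      rw [sum_comm]
      refine sum_congr rfl fun i _ => ?_
      rw [sum_card_nb_comm]
      simp [card_nb_univ]
    have hlow : (p * M : ℝ) * ((1 - 1 / p : ℝ) * Fintype.card V - C) ≤ ∑ x, (d x : ℝ) := by
      have h1 : ∀ i ∈ (univ : Finset (Fin p)), (M : ℝ) * ((1 - 1 / p : ℝ) * Fintype.card V - C) ≤
          ∑ b ∈ B i, (G.degree b : ℝ) := by
        intro i _
        have := card_nsmul_le_sum (B i) (fun b => (G.degree b : ℝ)) _ fun b _ => hdeg b
        rwa [hM i, nsmul_eq_mul] at this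
      have h2 := sum_le_sum h1
      simp only [sum_const, card_univ, Fintype.card_fin, nsmul_eq_mul] at h2
      have h3 : ∑ x, (d x : ℝ) = ∑ i, ∑ b ∈ B i, (G.degree b : ℝ) := by exact_mod_cast hdsum
      rw [h3]; linarith
    have hsum' : (∑ x, (d x : ℝ)) + Fintype.card V * M + #Y * (K * m) ≤
        Fintype.card V * (p * M) + Fintype.card V * m + #A * M := by
      have : (∑ x, d x) + Fintype.card V * M + #Y * (K * m) ≤
        Fintype.card V * (p * M) + Fintype.card V * m + #A * M := by linarith
      exact_mod_cast this
    have hp' : (p : ℝ) ≠ 0 := by positivity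
    have hexp : (p * M : ℝ) * ((1 - 1 / p : ℝ) * Fintype.card V - C) =
        Fintype.card V * (p * M) - Fintype.card V * M - p * M * C := by field_simp
    linarith

/-- The minimum-degree form of Erdős–Stone with `r = p - 1`. Half of the gap between `1/(p - 1)` and
`1/p` is the required surplus `e`; the other half absorbs `C`. -/
lemma exists_completeFamily (p M : ℕ) (hp : 2 ≤ p) (C : ℝ) :
    ∃ N : ℕ, ∀ (V : Type) [Fintype V] (G : SimpleGraph V), N ≤ Fintype.card V →
      (∀ v, (1 - 1 / p : ℝ) * Fintype.card V - C ≤ G.degree v) →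
      ∃ B : Fin p → Finset V, CompleteFamily G B ∧ ∀ i, #(B i) = M := by
  obtain ⟨r, rfl⟩ : ∃ r, p = r + 1 := ⟨p - 1, by omega⟩
  have hr : (0 : ℝ) < r := by exact_mod_cast (by omega : 0 < r)
  set e : ℝ := (1 / r - 1 / ((r + 1 : ℕ) : ℝ)) / 2 with he
  have he0 : 0 < e := by
    have : 1 / ((r + 1 : ℕ) : ℝ) < 1 / r := by
      apply one_div_lt_one_div_of_lt hr; push_cast; linarith
    rw [he]; linarith
  obtain ⟨N, hN⟩ := Filter.eventually_atTop.1
    (eventually_completeEquipartiteGraph_isContained_of_minDegree he0 r M)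
  obtain ⟨N', hN'⟩ := exists_nat_mul_ge C he0
  refine ⟨max 1 (max N N'), fun V _ G hn hdeg => ?_⟩
  have hcard : 0 < Fintype.card V := by omega
  let φ := Fintype.equivFin V
  let G' : SimpleGraph (Fin (Fintype.card V)) := G.map φ.toEmbedding
  let ψ : G ≃g G' := Iso.map φ G
  have : Nonempty (Fin (Fintype.card V)) := ⟨⟨0, hcard⟩⟩
  have hmin : (G'.minDegree : ℝ) ≥ (1 - 1 / r + e) * (Fintype.card V : ℕ) := by
    obtain ⟨v, hv⟩ := G'.exists_minimal_degree_vertex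
    obtain ⟨w, rfl⟩ := ψ.surjective v
    rw [hv, ψ.degree_eq]
    have h1 := hdeg w
    have h2 := hN' (Fintype.card V) (by omega)
    have h3 : (1 - 1 / r + e) * (Fintype.card V : ℝ) =
      (1 - 1 / ((r + 1 : ℕ) : ℝ)) * Fintype.card V - e * Fintype.card V := by rw [he]; ring
    linarith
  obtain ⟨f⟩ := (hN (Fintype.card V) (by omega) hmin).trans ψ.isContained'
  refine ⟨fun i => univ.map ⟨fun j => f (i, j), fun a b hab => ?_⟩, ?_, ?_⟩
  · simpa using f.injective hab
  · intro i j hij x hx y hy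
    simp only [mem_map, mem_univ, true_and] at hx hy
    obtain ⟨a, rfl⟩ := hx
    obtain ⟨b, rfl⟩ := hy
    exact f.toHom.map_adj (by simpa using hij)
  · intro i; simp

/-- Choice of constants for the trichotomy. A large `K` makes the intermediate set at most about `n
/ K`; then `Q`, large in terms of `K`, gives the family classes of size `m * Q` and makes the double
count bounding `#(U i)` sharp. -/
lemma exists_types (p m : ℕ) (hp : 2 ≤ p) (hm : 0 < m) (C : ℝ) (hC : 0 ≤ C) {ε : ℝ} (hε : 0 < ε) :
    ∃ N : ℕ, ∀ (V : Type) [Fintype V] (G : SimpleGraph V), N ≤ Fintype.card V →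
      (∀ v, (1 - 1 / p : ℝ) * Fintype.card V - C ≤ G.degree v) → NoBlowup G p m →
      ∃ B U : Fin p → Finset V, CompleteFamily G B ∧ (∀ i j, i ≠ j → Disjoint (U i) (U j)) ∧
      (∀ i j, i ≠ j → ∀ S ⊆ U i, #S ≤ 2 * m → m ≤ #{b ∈ B j | ∀ x ∈ S, G.Adj x b}) ∧
      (∀ i, (#(U i) : ℝ) ≤ (1 / p + ε) * Fintype.card V) ∧
      (1 - ε) * Fintype.card V ≤ ∑ i, (#(U i) : ℝ) := by
  obtain ⟨K, hK⟩ := exists_nat_ge (2 / ε + 1)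
  obtain ⟨Q, hQ⟩ := exists_nat_ge (2 / ε + 2 * m * K + K + 3)
  have hεK : 2 ≤ ε * K := by
    have : 2 / ε ≤ K := by linarith
    rwa [div_le_iff₀' hε] at this
  have hεQ : 2 ≤ ε * (Q - 1) := by
    have : 2 / ε ≤ (Q - 1 : ℝ) := by
      have : (0 : ℝ) ≤ 2 * m * K := by positivity
      have : (0 : ℝ) ≤ K := by positivity
      linarith
    rwa [div_le_iff₀' hε] at this
  have hQn : 2 * m * K + K + 3 ≤ Q := by
    have : (2 * m * K + K + 3 : ℝ) ≤ Q := by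
      have : 0 ≤ 2 / ε := by positivity
      linarith
    exact_mod_cast this
  set M := m * Q with hM
  obtain ⟨N₁, hN₁⟩ := exists_completeFamily p M hp C
  set a₀ : ℕ := m * 2 ^ (p * M) with ha₀
  obtain ⟨N₂, hN₂⟩ := exists_nat_mul_ge (2 * (a₀ + a₀ * M + p * M * C)) hε
  obtain ⟨N₃, hN₃⟩ := exists_nat_mul_ge (2 * (C * Q)) hε
  refine ⟨max N₁ (max N₂ N₃), fun V _ G hn hdeg hfree => ?_⟩
  obtain ⟨B, hB, hBM⟩ := hN₁ V G (by omega) hdeg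
  have h2 := hN₂ (Fintype.card V) (by omega)
  have h3 := hN₃ (Fintype.card V) (by omega)
  have hmQ : 2 * m * (K * m) + K * m + 3 * m ≤ m * Q := by
    calc 2 * m * (K * m) + K * m + 3 * m = m * (2 * m * K + K + 3) := by ring
      _ ≤ m * Q := Nat.mul_le_mul_left m hQn
  obtain ⟨U, hU1, hU2, hU3, a, y, ha, hsum, hy⟩ := exists_types_of_family (K := K) (by omega) hB hBM
    hfree (by rw [hM]; omega) hm (by rw [hM]; omega) hdeg
  have hp0 : (0 : ℝ) < p := by exact_mod_cast (by omega : 0 < p)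
  have hp1 : (1 : ℝ) ≤ p := by exact_mod_cast (by omega : 1 ≤ p)
  have hm0 : (1 : ℝ) ≤ m := by exact_mod_cast hm
  set n : ℝ := (Fintype.card V : ℝ) with hn'
  have hn0 : 0 ≤ n := by positivity
  refine ⟨B, U, hB, hU1, hU2, fun i => ?_, ?_⟩
  · have h := hU3 i
    set u : ℝ := (#(U i) : ℝ) with hu
    have hMr : (M : ℝ) = m * Q := by rw [hM]; push_cast; ring
    rw [hMr] at h
    have h' : (Q : ℝ) * (u - n / p - C) ≤ u := by
      have : (m : ℝ) * (Q * (u - n / p - C)) ≤ m * u := by linarith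
      exact le_of_mul_le_mul_left this (by linarith)
    have hQ1 : 0 < (Q : ℝ) - 1 := by
      by_contra hcon
      nlinarith
    have hnp : n / p ≤ n := div_le_self hn0 hp1
    have h5 : (Q - 1 : ℝ) * u ≤ (Q - 1) * (n / p + ε * n) := by
      have h6 : 2 * n ≤ ε * (Q - 1) * n := mul_le_mul_of_nonneg_right hεQ hn0
      have h7 : 2 * (C * Q) ≤ ε * (Q - 1) * n := by
        have : (1 : ℝ) ≤ Q - 1 := by
          have : (3 : ℝ) ≤ Q := by exact_mod_cast (by omega : 3 ≤ Q)
          linarith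
        have : ε * n * 1 ≤ ε * n * (Q - 1) := mul_le_mul_of_nonneg_left this (by positivity)
        linarith
      nlinarith
    have h8 := le_of_mul_le_mul_left h5 hQ1
    have : (1 / p + ε) * n = n / p + ε * n := by ring
    linarith
  · have hsum' : n ≤ ∑ i, (#(U i) : ℝ) + a + y := by rw [hn']; exact_mod_cast hsum
    have ha' : (a : ℝ) ≤ a₀ := by exact_mod_cast ha
    have hy2 : (y : ℝ) * K ≤ n + a * M + p * M * C := by
      have h0 : (0 : ℝ) ≤ a * M + p * M * C := by positivity
      have : (m : ℝ) * (y * K) ≤ m * (n + a * M + p * M * C) := by nlinarith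
      exact le_of_mul_le_mul_left this (by linarith)
    have hy3 : (y : ℝ) * 2 ≤ ε * (n + a * M + p * M * C) := by
      have : (y : ℝ) * 2 ≤ y * (ε * K) := mul_le_mul_of_nonneg_left hεK (by positivity)
      have := mul_le_mul_of_nonneg_left hy2 hε.le
      linarith
    have haM : (a : ℝ) * M ≤ a₀ * M := mul_le_mul_of_nonneg_right ha' (by positivity)
    by_cases hε1 : ε ≤ 1
    · have h0 : (0 : ℝ) ≤ a * M + p * M * C := by positivity
      have h9 : ε * (a * M + p * M * C) ≤ a * M + p * M * C := mul_le_of_le_one_left h0 hε1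
      linarith
    · have h0 : 0 ≤ ∑ i, (#(U i) : ℝ) := sum_nonneg fun i _ => by positivity
      nlinarith

/-- From `M₀` vertices with linear degree inside `U`, double counting and pigeonhole produce a
complete bipartite graph with sides of size `m` inside `U`. Its `2 * m` vertices have `m` common
neighbours in every `B j` with `j ≠ i`, so its sides can replace `B i` as two classes, giving `p +
1` classes in all. -/
lemma card_lt_of_many_nb {V : Type} [Fintype V] {G : SimpleGraph V} {p m : ℕ} {B : Fin p → Finset V}
    (hB : CompleteFamily G B) (hfree : NoBlowup G p m) (hm : 0 < m) {U : Finset V} {i : Fin p}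
    (hU : ∀ j, i ≠ j → ∀ S ⊆ U, #S ≤ 2 * m → m ≤ #{b ∈ B j | ∀ x ∈ S, G.Adj x b})
    {M₀ : ℕ} {ε : ℝ} (hM₀ : 2 * m ≤ ε * M₀) (hn : M₀ * 2 ^ M₀ < Fintype.card V) :
    #{x ∈ U | ε * Fintype.card V ≤ #(nb G x U)} < M₀ := by
  by_contra! hcon
  obtain ⟨D, hD, hDc⟩ := exists_subset_card_eq hcon
  set Y : Finset V := {y ∈ U | m ≤ #(nb G y D)} with hY
  have h1 : (M₀ : ℝ) * (ε * Fintype.card V) ≤ ∑ x ∈ D, (#(nb G x U) : ℝ) := by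
    have := card_nsmul_le_sum D (fun x => (#(nb G x U) : ℝ)) (ε * Fintype.card V)
      fun x hx => (mem_filter.1 (hD hx)).2
    rwa [hDc, nsmul_eq_mul] at this
  have h2 : ∑ x ∈ D, #(nb G x U) ≤ Fintype.card V * m + #Y * M₀ := by
    rw [sum_card_nb_comm]
    have h3 : ∀ y ∈ U, #(nb G y D) ≤ m + if y ∈ Y then M₀ else 0 := by
      intro y hy
      by_cases h : y ∈ Y
      · simp only [h, if_true]
        have := card_le_card (nb_subset G y D)
        omega
      · simp only [h, if_false]
        simp only [hY, mem_filter, not_and, not_le] at h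
        have := h hy
        omega
    refine (sum_le_sum h3).trans ?_
    rw [sum_add_distrib, sum_const, sum_ite_mem, sum_const, smul_eq_mul, smul_eq_mul]
    have h4 : #U ≤ Fintype.card V := card_le_univ U
    have h5 : #(U ∩ Y) ≤ #Y := card_le_card inter_subset_right
    exact Nat.add_le_add (Nat.mul_le_mul_right _ h4) (Nat.mul_le_mul_right _ h5)
  have h3 : Fintype.card V * m ≤ #Y * M₀ := by
    have h2' : ∑ x ∈ D, (#(nb G x U) : ℝ) ≤ Fintype.card V * m + #Y * M₀ := by exact_mod_cast h2
    have h4 : (2 * m : ℝ) * Fintype.card V ≤ ε * M₀ * Fintype.card V :=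
      mul_le_mul_of_nonneg_right hM₀ (by positivity)
    have : (Fintype.card V * m : ℝ) ≤ #Y * M₀ := by linarith
    exact_mod_cast this
  have h4 : m * 2 ^ #D < #Y := by
    rw [hDc]
    by_contra! h
    have h5 : #Y * M₀ ≤ m * 2 ^ M₀ * M₀ := Nat.mul_le_mul_right _ h
    have h6 : m * (M₀ * 2 ^ M₀) < m * Fintype.card V := Nat.mul_lt_mul_of_pos_left hn hm
    nlinarith
  obtain ⟨Q, hQ, A', hA', ht, hQA⟩ := exists_same_nb G Y D m h4
  have hQm : m ≤ #Q := by
    obtain ⟨a, ha⟩ : A'.Nonempty := card_pos.1 (by omega)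
    rw [← hQA a ha]
    exact (mem_filter.1 (hA' ha)).2
  obtain ⟨Q₁, hQ₁, hQ₁c⟩ := exists_subset_card_eq hQm
  obtain ⟨A₁, hA₁, hA₁c⟩ := exists_subset_card_eq ht.le
  have hQA₁ : ∀ x ∈ Q₁, ∀ y ∈ A₁, G.Adj x y := by
    intro x hx y hy
    have := hQ₁ hx
    rw [← hQA y (hA₁ hy)] at this
    exact (mem_nb.1 this).2.symm
  have hSU : Q₁ ∪ A₁ ⊆ U := by
    refine union_subset (fun x hx => ?_) fun x hx => ?_
    · exact (mem_filter.1 (hD (hQ (hQ₁ hx)))).1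
    · exact (mem_filter.1 (hA' (hA₁ hx))).1
  have hSc : #(Q₁ ∪ A₁) ≤ 2 * m := by
    have := card_union_le Q₁ A₁
    omega
  let R : Fin p → Finset V := fun j =>
    if i = j then A₁ else {b ∈ B j | ∀ x ∈ Q₁ ∪ A₁, G.Adj x b}
  have hQR : ∀ j, ∀ x ∈ Q₁, ∀ y ∈ R j, G.Adj x y := by
    intro j x hx y hy
    by_cases h : i = j
    · simp only [R, h, if_true] at hy
      exact hQA₁ x hx y hy
    · simp only [R, h, if_false, mem_filter] at hy
      exact hy.2 x (mem_union_left _ hx)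
  have hRR : ∀ j l, j ≠ l → ∀ x ∈ R j, ∀ y ∈ R l, G.Adj x y := by
    intro j l hjl x hx y hy
    by_cases h : i = j
    · have h' : i ≠ l := fun h' => hjl (h.symm.trans h')
      simp only [R, h, if_true] at hx
      simp only [R, h', if_false, mem_filter] at hy
      exact hy.2 x (mem_union_right _ hx)
    · simp only [R, h, if_false, mem_filter] at hx
      by_cases h' : i = l
      · simp only [R, h', if_true] at hy
        exact (hx.2 y (mem_union_right _ hy)).symm
      · simp only [R, h', if_false, mem_filter] at hy
        exact hB j l hjl x hx.1 y hy.1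
  obtain ⟨o, ho⟩ := hfree (fun o => o.elim Q₁ R) (by
    rintro (_ | j) (_ | l) hjl x hx y hy
    · exact absurd rfl hjl
    · exact hQR l x hx y hy
    · exact (hQR j y hy x hx).symm
    · exact hRR j l (fun h => hjl (by rw [h])) x hx y hy)
  rcases o with _ | j
  · simp [hQ₁c] at ho
  · simp only [Option.elim_some, R] at ho
    by_cases h : i = j
    · simp [h, hA₁c] at ho
    · simp only [h, if_false] at ho
      exact absurd (hU j h _ hSU hSc) (by omega)

/-- A graph of large minimum degree without large complete `(p + 1)`-partite subgraph is close to
a balanced complete `p`-partite graph. -/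
theorem exists_core (p m : ℕ) (hp : 2 ≤ p) (hm : 0 < m) (C : ℝ) (hC : 0 ≤ C) {ε : ℝ} (hε : 0 < ε) :
    ∃ N : ℕ, ∀ (V : Type) [Fintype V] (G : SimpleGraph V), N ≤ Fintype.card V →
      (∀ v, (1 - 1 / p : ℝ) * Fintype.card V - C ≤ G.degree v) → NoBlowup G p m →
      ∃ P : Fin p → Finset V, (∀ i j, i ≠ j → Disjoint (P i) (P j)) ∧
      (∀ i j, i ≠ j → ∀ x ∈ P i, (#{y ∈ P j | ¬ G.Adj x y} : ℝ) ≤ ε * Fintype.card V) ∧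
      (∀ i, (#(P i) : ℝ) ≤ (1 / p + ε) * Fintype.card V) ∧
      (1 - ε) * Fintype.card V ≤ ∑ i, (#(P i) : ℝ) := by
  have hp0 : (0 : ℝ) < p := by exact_mod_cast (by omega : 0 < p)
  set δ : ℝ := ε / (2 * (p + 1)) with hδ
  have hδ0 : 0 < δ := by positivity
  have hδε : (p + 1) * δ = ε / 2 := by rw [hδ]; field_simp
  obtain ⟨N₁, hN₁⟩ := exists_types p m hp hm C hC hδ0
  obtain ⟨M₀, hM₀⟩ := exists_nat_ge (2 * m / δ)
  rw [div_le_iff₀' hδ0] at hM₀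
  obtain ⟨N₂, hN₂⟩ := exists_nat_mul_ge (2 * C) hε
  obtain ⟨N₃, hN₃⟩ := exists_nat_mul_ge (2 * (p * M₀)) hε
  refine ⟨max N₁ (max N₂ (max N₃ (M₀ * 2 ^ M₀ + 1))), fun V _ G hn hdeg hfree => ?_⟩
  obtain ⟨B, U, hB, hU1, hU2, hU3, hU4⟩ := hN₁ V G (by omega) hdeg hfree
  have hC' := hN₂ (Fintype.card V) (by omega)
  have hM' := hN₃ (Fintype.card V) (by omega)
  set n : ℝ := (Fintype.card V : ℝ) with hn'
  have hn0 : 0 ≤ n := by positivity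
  set D : Fin p → Finset V := fun i => {x ∈ U i | δ * Fintype.card V ≤ #(nb G x (U i))} with hD
  have hDc : ∀ i, #(D i) < M₀ := fun i =>
    card_lt_of_many_nb hB hfree hm (fun j hij => hU2 i j hij) hM₀ (by omega)
  have hδε' : δ ≤ ε / 2 := by nlinarith
  have hUlow : ∀ i, (1 / p - p * δ) * n ≤ #(U i) := by
    intro i
    have h1 := add_sum_erase univ (fun j => (#(U j) : ℝ)) (mem_univ i)
    have h2 := sum_le_card_nsmul (univ.erase i) (fun j => (#(U j) : ℝ)) _ fun j _ => hU3 j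
    rw [card_erase_of_mem (mem_univ i), card_univ, Fintype.card_fin, nsmul_eq_mul,
      Nat.cast_sub (by omega)] at h2
    have h3 : ((p : ℝ) - (1 : ℕ)) * ((1 / p + δ) * n) =
        (1 - 1 / p + p * δ - δ) * n := by field_simp; push_cast; ring
    rw [h3] at h2
    nlinarith
  refine ⟨fun i => U i \ D i, ?_, ?_, ?_, ?_⟩
  · intro i j hij
    exact (hU1 i j hij).mono sdiff_subset sdiff_subset
  · intro i j hij x hx
    rw [mem_sdiff] at hx
    -- The vertex already misses nearly all of its own class, about `n/p` vertices, and the minimum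
    -- degree allows hardly any further non-neighbours.
    have h1 : (#(nb G x (U i)) : ℝ) < δ * n := by
      by_contra! h
      exact hx.2 (mem_filter.2 ⟨hx.1, h⟩)
    have h2 := card_le_add_of_degree G x (U i ∪ U j)
    rw [card_union_of_disjoint (hU1 i j hij)] at h2
    have h3 : #(nb G x (U i ∪ U j)) ≤ #(nb G x (U i)) + #(nb G x (U j)) := by
      rw [nb, filter_union]; exact card_union_le _ _
    have h4 := card_nb_add_card_not G x (U j)
    have h5 : #{y ∈ U j \ D j | ¬ G.Adj x y} ≤ #{y ∈ U j | ¬ G.Adj x y} :=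
      card_le_card (filter_subset_filter _ sdiff_subset)
    have h6 : #(U i) + #{y ∈ U j \ D j | ¬ G.Adj x y} + G.degree x ≤
      #(nb G x (U i)) + Fintype.card V := by omega
    have h7 : (#(U i) : ℝ) + #{y ∈ U j \ D j | ¬ G.Adj x y} + G.degree x ≤
      #(nb G x (U i)) + n := by rw [hn']; exact_mod_cast h6
    have h8 := hdeg x
    have h9 := hUlow i
    have h10 : ((p : ℝ) + 1) * δ * n = ε / 2 * n := by rw [hδε]
    nlinarith
  · intro i
    have h1 : (#(U i \ D i) : ℝ) ≤ #(U i) := by exact_mod_cast card_le_card sdiff_subset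
    have h2 := hU3 i
    nlinarith
  · have h1 : ∀ i ∈ (univ : Finset (Fin p)), (#(U i) : ℝ) ≤ #(U i \ D i) + M₀ := by
      intro i _
      have h2 := le_card_sdiff (D i) (U i)
      have h3 := hDc i
      have : #(U i) ≤ #(U i \ D i) + M₀ := by omega
      exact_mod_cast this
    have h2 := sum_le_sum h1
    rw [sum_add_distrib] at h2
    simp only [sum_const, card_univ, Fintype.card_fin, nsmul_eq_mul] at h2
    nlinarith

/-! ### Embedding edge blow-ups into a core -/

/-- Greedy choice: each vertex already placed excludes itself and at most `ξ` non-neighbours in the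
class of the next one, whence the threshold `Fintype.card ι * (ξ + 1)`. -/
lemma exists_transversal {V ι : Type} [Fintype ι] {G : SimpleGraph V} {p : ℕ}
    {P : Fin p → Finset V} {ξ : ℝ} (hξ : 0 ≤ ξ)
    (hP : ∀ i j, i ≠ j → ∀ x ∈ P i, (#{y ∈ P j | ¬ G.Adj x y} : ℝ) ≤ ξ)
    (c : ι → Fin p) (A : ι → Finset V) (hA : ∀ u, A u ⊆ P (c u))
    (hcard : ∀ u, Fintype.card ι * (ξ + 1) < #(A u)) :
    ∃ f : ι → V, Function.Injective f ∧ (∀ u, f u ∈ A u) ∧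
      ∀ u v, c u ≠ c v → G.Adj (f u) (f v) := by
  have hne : ∀ u, (A u).Nonempty := fun u => by
    rw [← card_pos]
    have := hcard u
    have h0 : (0 : ℝ) ≤ Fintype.card ι * (ξ + 1) := by positivity
    exact_mod_cast lt_of_le_of_lt h0 this
  suffices h : ∀ s : Finset ι, ∃ f : ι → V, Set.InjOn f s ∧ (∀ u, f u ∈ A u) ∧
      ∀ u ∈ s, ∀ v ∈ s, c u ≠ c v → G.Adj (f u) (f v) by
    obtain ⟨f, h1, h2, h3⟩ := h univ
    exact ⟨f, by simpa [Set.injOn_univ] using h1, h2, fun u v => h3 u (mem_univ _) v (mem_univ _)⟩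
  intro s
  induction s using Finset.induction_on with
  | empty => exact ⟨fun u => (hne u).choose, by simp, fun u => (hne u).choose_spec, by simp⟩
  | insert a s ha ih =>
    obtain ⟨f, h1, h2, h3⟩ := ih
    let Z : ι → Finset V := fun v =>
      insert (f v) (if c v ≠ c a then {y ∈ P (c a) | ¬ G.Adj (f v) y} else ∅)
    have hZ : ∀ v, (#(Z v) : ℝ) ≤ ξ + 1 := by
      intro v
      have h4 : (#(Z v) : ℝ) ≤ #(if c v ≠ c a then {y ∈ P (c a) | ¬ G.Adj (f v) y} else ∅) + 1 := by
        exact_mod_cast card_insert_le _ _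
      by_cases h : c v = c a
      · simp only [h, ne_eq, not_true_eq_false, if_false, card_empty] at h4
        push_cast at h4
        linarith
      · simp only [ne_eq, h, not_false_eq_true, if_true] at h4
        have := hP _ _ h (f v) (hA v (h2 v))
        linarith
    have hbig : ∃ y ∈ A a, y ∉ s.biUnion Z := by
      by_contra! hcon
      have h4 : #(A a) ≤ ∑ v ∈ s, #(Z v) :=
        (card_le_card (fun y hy => hcon y hy)).trans card_biUnion_le
      have h5 : (#(A a) : ℝ) ≤ ∑ v ∈ s, (#(Z v) : ℝ) := by exact_mod_cast h4
      have h6 := sum_le_card_nsmul s (fun v => (#(Z v) : ℝ)) _ fun v _ => hZ v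
      rw [nsmul_eq_mul] at h6
      have h7 : (#s : ℝ) ≤ Fintype.card ι := by exact_mod_cast card_le_univ s
      have h8 : (#s : ℝ) * (ξ + 1) ≤ Fintype.card ι * (ξ + 1) :=
        mul_le_mul_of_nonneg_right h7 (by linarith)
      linarith [hcard a]
    obtain ⟨y, hy, hyZ⟩ := hbig
    have hyZ' : ∀ v ∈ s, y ≠ f v ∧ (c v ≠ c a → G.Adj (f v) y) := by
      intro v hv
      have h4 : y ∉ Z v := fun h => hyZ (mem_biUnion.2 ⟨v, hv, h⟩)
      simp only [Z, mem_insert, not_or] at h4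
      refine ⟨h4.1, fun hc => ?_⟩
      have h5 := h4.2
      simp only [ne_eq, hc, not_false_eq_true, if_true, mem_filter, not_and, not_not] at h5
      exact h5 (hA a hy)
    have hupd : ∀ v ∈ s, Function.update f a y v = f v := fun v hv => by
      rw [Function.update_of_ne]; rintro rfl; exact ha hv
    refine ⟨Function.update f a y, ?_, ?_, ?_⟩
    · intro u hu v hv huv
      rw [mem_coe, mem_insert] at hu hv
      rcases hu with rfl | hu <;> rcases hv with rfl | hv
      · rfl
      · rw [hupd v hv, Function.update_self] at huv
        exact absurd huv (hyZ' v hv).1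
      · rw [hupd u hu, Function.update_self] at huv
        exact absurd huv.symm (hyZ' u hu).1
      · rw [hupd u hu, hupd v hv] at huv
        exact h1 hu hv huv
    · intro u
      by_cases h : u = a
      · subst h; simpa using hy
      · simpa [h] using h2 u
    · intro u hu v hv huv
      rw [mem_insert] at hu hv
      rcases hu with rfl | hu <;> rcases hv with rfl | hv
      · exact absurd rfl huv
      · rw [hupd v hv, Function.update_self]
        exact ((hyZ' v hv).2 huv.symm).symm
      · rw [hupd u hu, Function.update_self]
        exact (hyZ' u hu).2 huv
      · rw [hupd u hu, hupd v hv]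
        exact h3 u hu v hv huv

/-- `F` embeds in `G` if the vertices in `S` can be placed by `ψ`, the others are properly coloured
by `c`, and each of the latter has many candidates in the class of its colour. -/
lemma isContained_of_special {U V : Type} [Fintype U] {F : SimpleGraph U} {G : SimpleGraph V}
    {p : ℕ} {P : Fin p → Finset V} {ξ : ℝ} (hξ : 0 ≤ ξ)
    (hP : ∀ i j, i ≠ j → ∀ x ∈ P i, (#{y ∈ P j | ¬ G.Adj x y} : ℝ) ≤ ξ)
    (S : Set U) (ψ : U → V) (c : U → Fin p) (hinj : Set.InjOn ψ S)
    (hadj : ∀ u ∈ S, ∀ v ∈ S, F.Adj u v → G.Adj (ψ u) (ψ v))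
    (hcol : ∀ u ∉ S, ∀ v ∉ S, F.Adj u v → c u ≠ c v)
    (hcand : ∀ u ∉ S, Fintype.card U * (ξ + 2) <
      #{y ∈ P (c u) | ∀ v ∈ S, F.Adj v u → G.Adj (ψ v) y}) : F ⊑ G := by
  -- Removing the whole image of `ψ` keeps greedy vertices off the prescribed ones. It costs at most
  -- `Fintype.card U` candidates, which is why `hcand` has `ξ + 2` where the greedy step needs `ξ +
  -- 1`.
  let A : {u // u ∉ S} → Finset V := fun u =>
    {y ∈ P (c u) | ∀ v ∈ S, F.Adj v u → G.Adj (ψ v) y} \ univ.image ψ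
  obtain ⟨f, hf1, hf2, hf3⟩ := exists_transversal hξ hP (fun u : {u // u ∉ S} => c u) A
    (fun u => sdiff_subset.trans (filter_subset _ _)) (by
      intro u
      have h1 := hcand u u.2
      have h2 := le_card_sdiff (univ.image ψ)
        {y ∈ P (c u) | ∀ v ∈ S, F.Adj v u → G.Adj (ψ v) y}
      have h3 : #(univ.image ψ) ≤ Fintype.card U := card_image_le
      have h4 : #{y ∈ P (c u) | ∀ v ∈ S, F.Adj v u → G.Adj (ψ v) y} ≤ #(A u) + Fintype.card U := by
        have : #(A u) = #({y ∈ P (c u) | ∀ v ∈ S, F.Adj v u → G.Adj (ψ v) y} \ univ.image ψ) := rfl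
        omega
      have h5 : (#{y ∈ P (c u) | ∀ v ∈ S, F.Adj v u → G.Adj (ψ v) y} : ℝ) ≤
        #(A u) + Fintype.card U := by exact_mod_cast h4
      have h6 : (Fintype.card {u // u ∉ S} : ℝ) ≤ Fintype.card U := by
        exact_mod_cast Fintype.card_subtype_le _
      have h7 : (Fintype.card {u // u ∉ S} : ℝ) * (ξ + 1) ≤ Fintype.card U * (ξ + 1) :=
        mul_le_mul_of_nonneg_right h6 (by linarith)
      linarith)
  have hfA : ∀ u : {u // u ∉ S}, (∀ v ∈ S, F.Adj v u → G.Adj (ψ v) (f u)) ∧ ∀ v, ψ v ≠ f u := by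
    intro u
    have h := hf2 u
    simp only [A, mem_sdiff, mem_filter, mem_image, mem_univ, true_and, not_exists] at h
    exact ⟨h.1.2, h.2⟩
  let φ : U → V := fun u => if h : u ∈ S then ψ u else f ⟨u, h⟩
  have hφS : ∀ u ∈ S, φ u = ψ u := fun u hu => by simp [φ, hu]
  have hφf : ∀ u (hu : u ∉ S), φ u = f ⟨u, hu⟩ := fun u hu => by simp [φ, hu]
  refine ⟨⟨⟨φ, ?_⟩, ?_⟩⟩
  · intro u v huv
    by_cases hu : u ∈ S <;> by_cases hv : v ∈ S
    · rw [hφS u hu, hφS v hv]; exact hadj u hu v hv huv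
    · rw [hφS u hu, hφf v hv]; exact (hfA ⟨v, hv⟩).1 u hu huv
    · rw [hφf u hu, hφS v hv]; exact ((hfA ⟨u, hu⟩).1 v hv huv.symm).symm
    · rw [hφf u hu, hφf v hv]; exact hf3 _ _ (hcol u hu v hv huv)
  · intro u v huv
    replace huv : φ u = φ v := huv
    by_cases hu : u ∈ S <;> by_cases hv : v ∈ S
    · rw [hφS u hu, hφS v hv] at huv; exact hinj hu hv huv
    · rw [hφS u hu, hφf v hv] at huv; exact absurd huv ((hfA ⟨v, hv⟩).2 u)
    · rw [hφf u hu, hφS v hv] at huv; exact absurd huv.symm ((hfA ⟨u, hu⟩).2 v)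
    · rw [hφf u hu, hφf v hv] at huv
      exact congrArg Subtype.val (hf1 huv)

lemma exists_injOn_mapsTo {α β : Type} [Nonempty β] (X : Finset α) (Y : Finset β) (h : #X ≤ #Y) :
    ∃ f : α → β, Set.InjOn f X ∧ ∀ x ∈ X, f x ∈ Y := by
  have : Nonempty (X ↪ Y) := by
    rw [Function.Embedding.nonempty_iff_card_le, Fintype.card_coe, Fintype.card_coe]; exact h
  obtain ⟨g⟩ := this
  refine ⟨fun x => if hx : x ∈ X then (g ⟨x, hx⟩ : β) else Classical.arbitrary β, ?_, ?_⟩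
  · intro x hx y hy hxy
    rw [mem_coe] at hx hy
    simp only [hx, hy, dif_pos] at hxy
    exact congrArg Subtype.val (g.injective (Subtype.ext hxy))
  · intro x hx
    simp only [hx, dif_pos]
    exact (g ⟨x, hx⟩).2

lemma edgeBlowup_adj {τ : Type} {T : SimpleGraph τ} {m : ℕ} {x y : τ ⊕ T.edgeSet × Fin (m - 2)} :
    (edgeBlowup T m).Adj x y ↔ x ≠ y ∧ ∃ e : T.edgeSet, x ∈ edgeClique T m e ∧
      y ∈ edgeClique T m e := by
  simp only [edgeBlowup, fromRel_adj]
  constructor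
  · rintro ⟨h, ⟨e, h1, h2⟩ | ⟨e, h1, h2⟩⟩
    exacts [⟨h, e, h1, h2⟩, ⟨h, e, h2, h1⟩]
  · rintro ⟨h, e, h1, h2⟩
    exact ⟨h, Or.inl ⟨e, h1, h2⟩⟩

lemma inl_mem_edgeClique {τ : Type} {T : SimpleGraph τ} {m : ℕ} {e : T.edgeSet} {u : τ} :
    (Sum.inl u : τ ⊕ T.edgeSet × Fin (m - 2)) ∈ edgeClique T m e ↔ u ∈ (e : Sym2 τ) := Iff.rfl

lemma inr_mem_edgeClique {τ : Type} {T : SimpleGraph τ} {m : ℕ} {e f : T.edgeSet}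
    {i : Fin (m - 2)} :
    (Sum.inr (f, i) : τ ⊕ T.edgeSet × Fin (m - 2)) ∈ edgeClique T m e ↔ f = e := Iff.rfl

/-- Embedding of an edge blow-up: the vertices in the independent set `S` are placed by `ψ`, the
clique of an edge `e` that misses `S` contains the `g` new vertices `q e 0, …, q e (g - 1)`, and the
remaining vertices go to the classes `P i`. -/
theorem edgeBlowup_isContained {τ V : Type} [Fintype τ] {T : SimpleGraph τ} {G : SimpleGraph V}
    {p : ℕ} {P : Fin p → Finset V} {ξ L : ℝ} (hp : 0 < p) (hξ : 0 ≤ ξ)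
    (hP : ∀ i j, i ≠ j → ∀ x ∈ P i, (#{y ∈ P j | ¬ G.Adj x y} : ℝ) ≤ ξ)
    (hL : Fintype.card (τ ⊕ T.edgeSet × Fin (p + 1 - 2)) * (ξ + 2) ≤ L)
    (S : Set τ) (hS : ∀ u ∈ S, ∀ v ∈ S, ¬ T.Adj u v) (c : τ → Fin p) (ψ : τ → V)
    (hψ : Set.InjOn ψ S) (g : ℕ) (hg : g + 1 ≤ p) (I : Finset (Fin p)) (hI : #I + g = p + 1)
    (q : T.edgeSet → ℕ → V)
    (hqinj : ∀ e f : T.edgeSet, (∀ u ∈ (e : Sym2 τ), u ∉ S) → (∀ u ∈ (f : Sym2 τ), u ∉ S) →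
      ∀ i < g, ∀ j < g, q e i = q f j → e = f ∧ i = j)
    (hqψ : ∀ e : T.edgeSet, (∀ u ∈ (e : Sym2 τ), u ∉ S) → ∀ i < g, ∀ u ∈ S, q e i ≠ ψ u)
    (hqadj : ∀ e : T.edgeSet, (∀ u ∈ (e : Sym2 τ), u ∉ S) → ∀ i < g, ∀ j < g, i ≠ j →
      G.Adj (q e i) (q e j))
    (hcI : ∀ u v, T.Adj u v → u ∉ S → v ∉ S → c u ≠ c v ∧ c u ∈ I)
    (hψnb : ∀ s ∈ S, ∀ a, L < #(nb G (ψ s) (P a)))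
    (hqnb : ∀ e : T.edgeSet, (∀ u ∈ (e : Sym2 τ), u ∉ S) → ∀ a ∈ I,
      L < #{y ∈ P a | ∀ i < g, G.Adj (q e i) y})
    (hcand : ∀ u ∉ S, L < #{y ∈ P (c u) | (∀ s ∈ S, T.Adj s u → G.Adj (ψ s) y) ∧
      ∀ e : T.edgeSet, (∀ u ∈ (e : Sym2 τ), u ∉ S) → u ∈ (e : Sym2 τ) →
        ∀ i < g, G.Adj (q e i) y}) :
    edgeBlowup T (p + 1) ⊑ G := by
  have : Nonempty (Fin p) := ⟨⟨0, hp⟩⟩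
  let E : Set T.edgeSet := {e | ∀ u ∈ (e : Sym2 τ), u ∉ S}
  -- Colours for the `p - 1` new vertices of each clique. If the edge meets `S`, they avoid the
  -- colour of the end outside `S`. If it misses `S`, the first `g` are prescribed and the other `p
  -- - 1 - g` use `I` minus the two end colours, exactly enough because `#I + g = p + 1`.
  have hγ : ∀ e : T.edgeSet, ∃ γ : Fin (p + 1 - 2) → Fin p,
      (e ∉ E → Function.Injective γ ∧ ∀ i, ∀ u ∈ (e : Sym2 τ), u ∉ S → γ i ≠ c u) ∧
      (e ∈ E → (∀ i j : Fin (p + 1 - 2), g ≤ i.1 → g ≤ j.1 → γ i = γ j → i = j) ∧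
        ∀ i : Fin (p + 1 - 2), g ≤ i.1 → γ i ∈ I ∧ ∀ u ∈ (e : Sym2 τ), γ i ≠ c u) := by
    rintro ⟨e, he⟩
    induction e using Sym2.ind with
    | _ x y =>
    have hxy : T.Adj x y := he
    by_cases hE : (⟨s(x, y), he⟩ : T.edgeSet) ∈ E
    · have hx : x ∉ S := hE x (by simp)
      have hy : y ∉ S := hE y (by simp)
      have h1 := hcI x y hxy hx hy
      have h2 := hcI y x hxy.symm hy hx
      have hcX : #({i : Fin (p + 1 - 2) | g ≤ i.1} : Finset _) ≤ #((I.erase (c x)).erase (c y)) := by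
        rw [card_erase_of_mem (mem_erase.2 ⟨h2.1, h2.2⟩), card_erase_of_mem h1.2]
        have h3 : #({i : Fin (p + 1 - 2) | i.1 < g} : Finset _) = g := by
          rw [Fin.card_filter_val_lt]; omega
        have h4 := card_filter_add_card_filter_not (s := (univ : Finset (Fin (p + 1 - 2))))
          (fun i => i.1 < g)
        simp only [not_lt, card_univ, Fintype.card_fin] at h4
        omega
      obtain ⟨γ, hγ1, hγ2⟩ := exists_injOn_mapsTo _ _ hcX
      refine ⟨γ, fun h => absurd hE h, fun _ => ⟨fun i j hi hj hij => ?_, fun i hi => ?_⟩⟩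
      · exact hγ1 (by simpa using hi) (by simpa using hj) hij
      · have h3 := hγ2 i (by simpa using hi)
        simp only [mem_erase] at h3
        refine ⟨h3.2.2, fun u hu => ?_⟩
        rcases Sym2.mem_iff.1 hu with rfl | rfl
        exacts [h3.2.1, h3.1]
    · obtain ⟨z, hz, hzS⟩ : ∃ z, (∀ u ∈ s(x, y), u ∉ S → u = z) ∧ z ∈ s(x, y) := by
        have h1 : ∃ u ∈ s(x, y), u ∈ S := by
          by_contra! h
          exact hE h
        obtain ⟨u, hu, huS⟩ := h1
        rcases Sym2.mem_iff.1 hu with rfl | rfl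
        · refine ⟨y, fun v hv hvS => ?_, by simp⟩
          rcases Sym2.mem_iff.1 hv with rfl | rfl
          exacts [absurd huS hvS, rfl]
        · refine ⟨x, fun v hv hvS => ?_, by simp⟩
          rcases Sym2.mem_iff.1 hv with rfl | rfl
          exacts [rfl, absurd huS hvS]
      have hcX : #(univ : Finset (Fin (p + 1 - 2))) ≤ #((univ : Finset (Fin p)).erase (c z)) := by
        rw [card_erase_of_mem (mem_univ _)]; simp
      obtain ⟨γ, hγ1, hγ2⟩ := exists_injOn_mapsTo _ _ hcX
      refine ⟨γ, fun _ => ⟨fun i j hij => hγ1 (by simp) (by simp) hij, fun i u hu huS => ?_⟩,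
        fun h => absurd h hE⟩
      rw [hz u hu huS]
      exact (mem_erase.1 (hγ2 i (mem_univ _))).1
  choose γ hγ1 hγ2 using hγ
  -- The prescribed vertices of the blow-up: those of `S`, and the first `g` new vertices of each
  -- clique whose edge misses `S`.
  let S' : Set (τ ⊕ T.edgeSet × Fin (p + 1 - 2)) :=
    {x | Sum.elim (fun u => u ∈ S) (fun a => a.1 ∈ E ∧ a.2.1 < g) x}
  have hSl : ∀ u, (Sum.inl u : τ ⊕ T.edgeSet × Fin (p + 1 - 2)) ∈ S' ↔ u ∈ S := fun u => Iff.rfl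
  have hSr : ∀ e i, (Sum.inr (e, i) : τ ⊕ T.edgeSet × Fin (p + 1 - 2)) ∈ S' ↔ e ∈ E ∧ i.1 < g :=
    fun e i => Iff.rfl
  refine isContained_of_special hξ hP S' (Sum.elim ψ fun a => q a.1 a.2.1)
    (Sum.elim c fun a => γ a.1 a.2) ?_ ?_ ?_ ?_
  · rintro (u | ⟨e, i⟩) hu (v | ⟨f, j⟩) hv huv
    · rw [hψ hu hv huv]
    · exact absurd huv.symm (hqψ f hv.1 _ hv.2 u hu)
    · exact absurd huv (hqψ e hu.1 _ hu.2 v hv)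
    · obtain ⟨h1, h2⟩ := hqinj e f hu.1 hv.1 _ hu.2 _ hv.2 huv
      rw [h1, show i = j from Fin.ext h2]
  · rintro (u | ⟨e, i⟩) hu (v | ⟨f, j⟩) hv huv
    all_goals
      rw [edgeBlowup_adj] at huv
      obtain ⟨hne, e', h1, h2⟩ := huv
    · rw [inl_mem_edgeClique] at h1 h2
      have hne' : u ≠ v := fun h => hne (by rw [h])
      have : (e' : Sym2 τ) = s(u, v) := ((Sym2.mem_and_mem_iff hne').1 ⟨h1, h2⟩)
      have h3 := e'.2
      rw [this] at h3
      exact absurd h3 (hS u hu v hv)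
    · rw [inr_mem_edgeClique] at h2
      subst h2
      exact absurd hu (hv.1 u h1)
    · rw [inr_mem_edgeClique] at h1
      subst h1
      exact absurd hv (hu.1 v h2)
    · rw [inr_mem_edgeClique] at h1 h2
      subst h1
      subst h2
      exact hqadj f hu.1 _ hu.2 _ hv.2 fun h => hne (by rw [show i = j from Fin.ext h])
  · rintro (u | ⟨e, i⟩) hu (v | ⟨f, j⟩) hv huv
    all_goals
      rw [edgeBlowup_adj] at huv
      obtain ⟨hne, e', h1, h2⟩ := huv
    · rw [inl_mem_edgeClique] at h1 h2
      have hne' : u ≠ v := fun h => hne (by rw [h])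
      have : (e' : Sym2 τ) = s(u, v) := ((Sym2.mem_and_mem_iff hne').1 ⟨h1, h2⟩)
      have h3 := e'.2
      rw [this] at h3
      exact (hcI u v h3 hu hv).1
    · rw [inr_mem_edgeClique] at h2
      rw [inl_mem_edgeClique] at h1
      subst h2
      rw [hSr, not_and, not_lt] at hv
      by_cases hE : f ∈ E
      · exact (((hγ2 f hE).2 j (hv hE)).2 u h1).symm
      · exact ((hγ1 f hE).2 j u h1 hu).symm
    · rw [inr_mem_edgeClique] at h1
      rw [inl_mem_edgeClique] at h2
      subst h1
      rw [hSr, not_and, not_lt] at hu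
      by_cases hE : e ∈ E
      · exact ((hγ2 e hE).2 i (hu hE)).2 v h2
      · exact (hγ1 e hE).2 i v h2 hv
    · rw [inr_mem_edgeClique] at h1 h2
      subst h1
      subst h2
      rw [hSr, not_and, not_lt] at hu hv
      intro hij
      apply hne
      by_cases hE : f ∈ E
      · rw [show i = j from (hγ2 f hE).1 i j (hu hE) (hv hE) hij]
      · rw [show i = j from (hγ1 f hE).1 hij]
  · rintro (u | ⟨e, i⟩) hu
    · refine lt_of_le_of_lt hL (lt_of_lt_of_le (hcand u hu) ?_)
      refine Nat.cast_le.2 (card_le_card fun y hy => ?_)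
      simp only [mem_filter] at hy
      refine mem_filter.2 ⟨hy.1, ?_⟩
      rintro (v | ⟨f, j⟩) hv huv
      · rw [edgeBlowup_adj] at huv
        obtain ⟨hne, e', h1, h2⟩ := huv
        rw [inl_mem_edgeClique] at h1 h2
        have hne' : v ≠ u := fun h => hne (by rw [h])
        have : (e' : Sym2 τ) = s(v, u) := ((Sym2.mem_and_mem_iff hne').1 ⟨h1, h2⟩)
        have h3 := e'.2
        rw [this] at h3
        exact hy.2.1 v hv h3
      · rw [edgeBlowup_adj] at huv
        obtain ⟨hne, e', h1, h2⟩ := huv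
        rw [inr_mem_edgeClique] at h1
        rw [inl_mem_edgeClique] at h2
        subst h1
        exact hy.2.2 f hv.1 h2 _ hv.2
    · rw [hSr, not_and, not_lt] at hu
      by_cases hE : e ∈ E
      · have h1 := (hγ2 e hE).2 i (hu hE)
        refine lt_of_le_of_lt hL (lt_of_lt_of_le (hqnb e hE _ h1.1) ?_)
        refine Nat.cast_le.2 (card_le_card fun y hy => ?_)
        simp only [mem_filter] at hy
        refine mem_filter.2 ⟨hy.1, ?_⟩
        rintro (v | ⟨f, j⟩) hv huv
        all_goals
          rw [edgeBlowup_adj] at huv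
          obtain ⟨hne, e', h1, h2⟩ := huv
          rw [inr_mem_edgeClique] at h2
          subst h2
        · exact absurd hv (hE v h1)
        · rw [inr_mem_edgeClique] at h1
          subst h1
          exact hy.2 _ hv.2
      · obtain ⟨s, hs, hsS⟩ : ∃ s ∈ (e : Sym2 τ), s ∈ S := by
          by_contra! h
          exact hE h
        refine lt_of_le_of_lt hL (lt_of_lt_of_le (hψnb s hsS (γ e i)) ?_)
        refine Nat.cast_le.2 (card_le_card fun y hy => ?_)
        rw [mem_nb] at hy
        refine mem_filter.2 ⟨hy.1, ?_⟩
        rintro (v | ⟨f, j⟩) hv huv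
        all_goals
          rw [edgeBlowup_adj] at huv
          obtain ⟨hne, e', h1, h2⟩ := huv
          rw [inr_mem_edgeClique] at h2
          subst h2
        · rw [inl_mem_edgeClique] at h1
          by_cases hvs : v = s
          · subst hvs; exact hy.2
          · have h3 : (e : Sym2 τ) = s(v, s) := ((Sym2.mem_and_mem_iff hvs).1 ⟨h1, hs⟩)
            have h4 := e.2
            rw [h3] at h4
            exact absurd h4 (hS v hv s hsS)
        · rw [inr_mem_edgeClique] at h1
          subst h1
          exact absurd hv.1 hE

/-- `S` is independent and meets every edge of `T` except `u₀v₀`; vertices outside `S` have at most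
two neighbours in `S`, and the ends of the exceptional edge at most one. -/
structure NearCover {τ : Type} (T : SimpleGraph τ) (S : Finset τ) (u₀ v₀ : τ) : Prop where
  adj : T.Adj u₀ v₀
  indep : ∀ u ∈ S, ∀ v ∈ S, ¬ T.Adj u v
  cover : ∀ u v, T.Adj u v → u ∉ S → v ∉ S → s(u, v) = s(u₀, v₀)
  exists_pair : ∀ u ∉ S, ∃ s ∈ S, ∃ s' ∈ S, ∀ w ∈ S, T.Adj w u → w = s ∨ w = s'
  exists_left : ∃ s ∈ S, ∀ w ∈ S, T.Adj w u₀ → w = s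
  exists_right : ∃ s ∈ S, ∀ w ∈ S, T.Adj w v₀ → w = s

/-- Embedding by means of a near cover `S` placed by `ψ`, and a clique `q` for the exceptional
edge. -/
lemma NearCover.isContained {τ V : Type} [Fintype τ] {T : SimpleGraph τ} {S : Finset τ} {u₀ v₀ : τ}
    (hT : NearCover T S u₀ v₀) {G : SimpleGraph V}
    {p : ℕ} {P : Fin p → Finset V} {ξ L : ℝ} (hp : 0 < p) (hξ : 0 ≤ ξ)
    (hP : ∀ i j, i ≠ j → ∀ x ∈ P i, (#{y ∈ P j | ¬ G.Adj x y} : ℝ) ≤ ξ)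
    (hL : Fintype.card (τ ⊕ T.edgeSet × Fin (p + 1 - 2)) * (ξ + 2) ≤ L) (ψ : τ → V)
    (hψ : Set.InjOn ψ S) (g : ℕ) (hg : g + 1 ≤ p) (I : Finset (Fin p)) (hI : #I + g = p + 1)
    (q : ℕ → V) (hqinj : ∀ i < g, ∀ j < g, q i = q j → i = j)
    (hqψ : ∀ i < g, ∀ u ∈ S, q i ≠ ψ u)
    (hqadj : ∀ i < g, ∀ j < g, i ≠ j → G.Adj (q i) (q j))
    (hψnb : ∀ s ∈ S, ∀ a, L < #(nb G (ψ s) (P a)))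
    (hpair : ∀ s ∈ S, ∀ s' ∈ S, ∃ a, L < #{y ∈ P a | G.Adj (ψ s) y ∧ G.Adj (ψ s') y})
    (hqnb : ∀ a ∈ I, L < #{y ∈ P a | ∀ i < g, G.Adj (q i) y})
    (hq : ∀ s ∈ S, ∀ s' ∈ S, ∃ a ∈ I, ∃ b ∈ I, a ≠ b ∧
      L < #{y ∈ P a | G.Adj (ψ s) y ∧ ∀ i < g, G.Adj (q i) y} ∧
      L < #{y ∈ P b | G.Adj (ψ s') y ∧ ∀ i < g, G.Adj (q i) y}) :
    edgeBlowup T (p + 1) ⊑ G := by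
  obtain ⟨s₀, hs₀, hs₀'⟩ := hT.exists_left
  obtain ⟨s₁, hs₁, hs₁'⟩ := hT.exists_right
  obtain ⟨a, ha, b, hb, hab, hLa, hLb⟩ := hq s₀ hs₀ s₁ hs₁
  have hc : ∀ u, ∃ a, u ∉ S → L < #{y ∈ P a | ∀ w ∈ S, T.Adj w u → G.Adj (ψ w) y} := by
    intro u
    by_cases hu : u ∈ S
    · exact ⟨⟨0, hp⟩, fun h => absurd hu h⟩
    · obtain ⟨s, hs, s', hs', h⟩ := hT.exists_pair u hu
      obtain ⟨a, ha⟩ := hpair s hs s' hs'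
      refine ⟨a, fun _ => lt_of_lt_of_le ha (Nat.cast_le.2 (card_le_card fun y hy => ?_))⟩
      simp only [mem_filter] at hy ⊢
      refine ⟨hy.1, fun w hw hwu => ?_⟩
      rcases h w hw hwu with rfl | rfl
      exacts [hy.2.1, hy.2.2]
  choose c' hc' using hc
  have huv : u₀ ≠ v₀ := hT.adj.ne
  -- Away from the exceptional edge no two vertices outside `S` are adjacent, so each may take any
  -- class rich in common neighbours of its at most two placed neighbours; only `u₀` and `v₀` need
  -- different colours.
  let c : τ → Fin p := fun u => if u = u₀ then a else if u = v₀ then b else c' u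
  have hcu : c u₀ = a := by simp [c]
  have hcv : c v₀ = b := by simp [c, huv.symm]
  have hE : ∀ e : T.edgeSet, (∀ u ∈ (e : Sym2 τ), u ∉ (S : Set τ)) → (e : Sym2 τ) = s(u₀, v₀) := by
    rintro ⟨e, he⟩
    induction e using Sym2.ind with
    | _ x y =>
    intro h
    exact hT.cover x y he (h x (by simp)) (h y (by simp))
  refine edgeBlowup_isContained hp hξ hP hL (S : Set τ) hT.indep c ψ hψ g hg I hI (fun _ => q)
    ?_ ?_ ?_ ?_ hψnb ?_ ?_
  · intro e f he hf i hi j hj hij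
    exact ⟨Subtype.ext ((hE e he).trans (hE f hf).symm), hqinj i hi j hj hij⟩
  · intro e _ i hi u hu
    exact hqψ i hi u hu
  · intro e _ i hi j hj hij
    exact hqadj i hi j hj hij
  · intro u v h hu hv
    rcases Sym2.eq_iff.1 (hT.cover u v h hu hv) with ⟨rfl, rfl⟩ | ⟨rfl, rfl⟩
    · rw [hcu, hcv]; exact ⟨hab, ha⟩
    · rw [hcu, hcv]; exact ⟨hab.symm, hb⟩
  · intro e _ a ha
    exact hqnb a ha
  · intro u hu
    by_cases h1 : u = u₀
    · subst h1
      rw [hcu]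
      refine lt_of_lt_of_le hLa (Nat.cast_le.2 (card_le_card fun y hy => ?_))
      simp only [mem_filter] at hy ⊢
      refine ⟨hy.1, fun s hs hsu => ?_, fun e _ _ i hi => hy.2.2 i hi⟩
      rw [hs₀' s hs hsu]; exact hy.2.1
    · by_cases h2 : u = v₀
      · subst h2
        rw [hcv]
        refine lt_of_lt_of_le hLb (Nat.cast_le.2 (card_le_card fun y hy => ?_))
        simp only [mem_filter] at hy ⊢
        refine ⟨hy.1, fun s hs hsu => ?_, fun e _ _ i hi => hy.2.2 i hi⟩
        rw [hs₁' s hs hsu]; exact hy.2.1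
      · have h3 : c u = c' u := by simp [c, h1, h2]
        rw [h3]
        refine lt_of_lt_of_le (hc' u hu) (Nat.cast_le.2 (card_le_card fun y hy => ?_))
        simp only [mem_filter] at hy ⊢
        refine ⟨hy.1, hy.2, fun e he hue => ?_⟩
        rw [hE e he] at hue
        rcases Sym2.mem_iff.1 hue with h | h
        exacts [absurd h h1, absurd h h2]

/-- Embedding by means of a matching inside one class. -/
lemma isContained_of_matching {τ V : Type} [Fintype τ] {T : SimpleGraph τ} (hcol : T.Colorable 2)
    {G : SimpleGraph V} {p : ℕ} {P : Fin p → Finset V} {ξ L : ℝ} (hp : 3 ≤ p) (hξ : 0 ≤ ξ)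
    (hP : ∀ i j, i ≠ j → ∀ x ∈ P i, (#{y ∈ P j | ¬ G.Adj x y} : ℝ) ≤ ξ)
    (hL : Fintype.card (τ ⊕ T.edgeSet × Fin (p + 1 - 2)) * (ξ + 2) ≤ L) (i : Fin p)
    (q : T.edgeSet → ℕ → V)
    (hqinj : ∀ e f, ∀ a < 2, ∀ b < 2, q e a = q f b → e = f ∧ a = b)
    (hqadj : ∀ e, G.Adj (q e 0) (q e 1))
    (hqnb : ∀ a, a ≠ i → L < #{y ∈ P a | ∀ e, ∀ j < 2, G.Adj (q e j) y}) :
    edgeBlowup T (p + 1) ⊑ G := by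
  obtain ⟨d⟩ := hcol
  obtain ⟨a, ha⟩ : ∃ a : Fin p, a ≠ i := by
    have : Nontrivial (Fin p) := Fin.nontrivial_iff_two_le.2 (by omega)
    exact exists_ne i
  -- Here `3 ≤ p` enters: the two colour classes of `T` go to two classes different from `i`, which
  -- hosts the matching.
  obtain ⟨b, hb⟩ : ∃ b : Fin p, b ∉ ({a, i} : Finset (Fin p)) := by
    by_contra! h
    have h1 : #(univ : Finset (Fin p)) ≤ #({a, i} : Finset (Fin p)) :=
      card_le_card fun x _ => h x
    have h2 : #({a, i} : Finset (Fin p)) ≤ 2 := card_le_two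
    simp at h1
    omega
  simp only [mem_insert, mem_singleton, not_or] at hb
  have : Nonempty V := by
    have h1 := hqnb a ha
    by_contra h
    rw [not_nonempty_iff] at h
    have h2 : #{y ∈ P a | ∀ e, ∀ j < 2, G.Adj (q e j) y} = 0 := by
      rw [card_eq_zero]; exact Finset.eq_empty_of_isEmpty _
    rw [h2] at h1
    have : (0 : ℝ) ≤ L := le_trans (by positivity) hL
    norm_num at h1
    linarith
  have hd : ∀ u v, d u ≠ d v → (if d u = 0 then a else b) ≠ if d v = 0 then a else b := by
    intro u v huv
    have h1 : ∀ x y : Fin 2, x ≠ y → (if x = 0 then a else b) ≠ if y = 0 then a else b := by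
      intro x y hxy
      have : (x = 0 ∧ y ≠ 0) ∨ (x ≠ 0 ∧ y = 0) := by omega
      rcases this with ⟨h1, h2⟩ | ⟨h1, h2⟩
      · simp only [h1, h2, if_true, if_false]; exact Ne.symm hb.1
      · simp only [h1, h2, if_true, if_false]; exact hb.1
    exact h1 _ _ huv
  have hI : ∀ u, (if d u = 0 then a else b) ≠ i := by
    intro u
    split_ifs
    exacts [ha, hb.2]
  -- With `S` empty every clique has `g = 2` prescribed new vertices, the ends of its matching edge,
  -- and the remaining colours are all but `i`.
  refine edgeBlowup_isContained (by omega) hξ hP hL ∅ (by simp) (fun u => if d u = 0 then a else b)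
    (fun _ => Classical.arbitrary V) (by simp) 2 hp (univ.erase i) ?_ q ?_ (by simp) ?_ ?_ (by simp)
    ?_ ?_
  · rw [card_erase_of_mem (mem_univ _), card_univ, Fintype.card_fin]; omega
  · intro e f _ _; exact hqinj e f
  · intro e _ x hx y hy hxy
    have : (x = 0 ∧ y = 1) ∨ (x = 1 ∧ y = 0) := by omega
    rcases this with ⟨rfl, rfl⟩ | ⟨rfl, rfl⟩
    exacts [hqadj e, (hqadj e).symm]
  · intro u v huv _ _
    exact ⟨hd u v (d.valid huv), mem_erase.2 ⟨hI u, mem_univ _⟩⟩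
  · intro e _ a ha
    refine lt_of_lt_of_le (hqnb a (mem_erase.1 ha).1) (Nat.cast_le.2 (card_le_card fun y hy => ?_))
    simp only [mem_filter] at hy ⊢
    exact ⟨hy.1, hy.2 e⟩
  · intro u _
    refine lt_of_lt_of_le (hqnb _ (hI u)) (Nat.cast_le.2 (card_le_card fun y hy => ?_))
    simp only [mem_filter] at hy ⊢
    exact ⟨hy.1, by simp, fun e _ _ => hy.2 e⟩

/-! ### Matchings, common neighbourhoods and degree sums -/

/-- A matching that cannot be extended has its set of ends as a vertex cover. -/
lemma exists_matching_or_cover {V : Type} (G : SimpleGraph V) (X : Finset V) (μ : ℕ) :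
    (∃ r : ℕ → ℕ → V, (∀ i < μ, ∀ j < μ, ∀ a < 2, ∀ b < 2, r i a = r j b → i = j ∧ a = b) ∧
      ∀ i < μ, (∀ a < 2, r i a ∈ X) ∧ G.Adj (r i 0) (r i 1)) ∨
    ∃ Q : Finset V, #Q ≤ 2 * μ ∧ ∀ x ∈ X, ∀ y ∈ X, G.Adj x y → x ∈ Q ∨ y ∈ Q := by
  by_cases hne : Nonempty V
  swap
  · rw [not_nonempty_iff] at hne
    exact Or.inr ⟨∅, by simp, fun x => (hne.false x).elim⟩
  induction μ with
  | zero => exact Or.inl ⟨fun _ _ => Classical.arbitrary V, by simp, by simp⟩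
  | succ μ ih =>
    rcases ih with ⟨r, hr1, hr2⟩ | ⟨Q, hQ1, hQ2⟩
    swap
    · exact Or.inr ⟨Q, by omega, hQ2⟩
    let Q : Finset V := (range μ ×ˢ range 2).image fun x => r x.1 x.2
    have hQc : #Q ≤ 2 * μ := by
      refine card_image_le.trans ?_
      simp [mul_comm]
    have hQ : ∀ i < μ, ∀ a < 2, r i a ∈ Q := fun i hi a ha =>
      mem_image.2 ⟨(i, a), by simp [hi, ha], rfl⟩
    by_cases h : ∀ x ∈ X, ∀ y ∈ X, G.Adj x y → x ∈ Q ∨ y ∈ Q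
    · exact Or.inr ⟨Q, by omega, h⟩
    push Not at h
    obtain ⟨x, hx, y, hy, hxy, hxQ, hyQ⟩ := h
    let w : ℕ → V := fun a => if a = 0 then x else y
    have hwQ : ∀ a, w a ∉ Q := by
      intro a; simp only [w]; split_ifs <;> assumption
    have hwinj : ∀ a < 2, ∀ b < 2, w a = w b → a = b := by
      intro a ha b hb hab
      by_contra hne
      have : (a = 0 ∧ b = 1) ∨ (a = 1 ∧ b = 0) := by omega
      rcases this with ⟨rfl, rfl⟩ | ⟨rfl, rfl⟩
      · simp [w] at hab; exact hxy.ne hab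
      · simp [w] at hab; exact hxy.ne hab.symm
    refine Or.inl ⟨Function.update r μ w, ?_, ?_⟩
    · intro i hi j hj a ha b hb hab
      by_cases h1 : i = μ <;> by_cases h2 : j = μ
      · subst h1; subst h2
        simp only [Function.update_self] at hab
        exact ⟨rfl, hwinj a ha b hb hab⟩
      · subst h1
        rw [Function.update_self, Function.update_of_ne h2] at hab
        exact absurd (hab ▸ hQ j (by omega) b hb) (hwQ a)
      · subst h2
        rw [Function.update_self, Function.update_of_ne h1] at hab
        exact absurd (hab ▸ hQ i (by omega) a ha) (hwQ b)
      · rw [Function.update_of_ne h1, Function.update_of_ne h2] at hab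
        exact hr1 i (by omega) j (by omega) a ha b hb hab
    · intro i hi
      by_cases h1 : i = μ
      · subst h1
        rw [Function.update_self]
        refine ⟨fun a _ => ?_, ?_⟩
        · simp only [w]; split_ifs <;> assumption
        · simpa [w] using hxy
      · rw [Function.update_of_ne h1]
        exact hr2 i (by omega)

/-- Fix `c` vertices of `W`. By double counting, at least `η n / 2` vertices of `X` see `m` or more
of them; one of the at most `2 ^ c` traces is shared by a constant proportion, and any `m` vertices
of that trace serve. -/
lemma exists_common_nb {η : ℝ} (hη : 0 < η) (m : ℕ) :
    ∃ c : ℕ, ∃ γ : ℝ, 0 < γ ∧ ∀ (V : Type) [Fintype V] (G : SimpleGraph V) (X W : Finset V),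
      c ≤ #W → (∀ w ∈ W, η * Fintype.card V ≤ #(nb G w X)) →
      ∃ S ⊆ W, #S = m ∧ γ * Fintype.card V ≤ #{y ∈ X | ∀ s ∈ S, G.Adj s y} := by
  obtain ⟨c, hc⟩ := exists_nat_ge (2 * m / η + m + 1)
  have hcm : m ≤ c := by
    have : (m : ℝ) ≤ c := by
      have : 0 ≤ 2 * m / η := by positivity
      linarith
    exact_mod_cast this
  have hc1 : (0 : ℝ) < c := by
    have : 0 ≤ 2 * m / η := by positivity
    have : (0 : ℝ) ≤ m := by positivity
    linarith
  have hc2 : 2 * m ≤ η * c := by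
    have : 2 * m / η ≤ c := by
      have : (0 : ℝ) ≤ m := by positivity
      linarith
    rwa [div_le_iff₀' hη] at this
  refine ⟨c, η / (2 * 2 ^ c), by positivity, fun V _ G X W hW hnb => ?_⟩
  obtain ⟨W₁, hW₁, hW₁c⟩ := exists_subset_card_eq hW
  set Y : Finset V := {y ∈ X | m ≤ #(nb G y W₁)} with hY
  have h1 : (c : ℝ) * (η * Fintype.card V) ≤ ∑ x ∈ W₁, (#(nb G x X) : ℝ) := by
    have := card_nsmul_le_sum W₁ (fun x => (#(nb G x X) : ℝ)) (η * Fintype.card V)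
      fun x hx => hnb x (hW₁ hx)
    rwa [hW₁c, nsmul_eq_mul] at this
  have h2 : ∑ x ∈ W₁, #(nb G x X) ≤ Fintype.card V * m + #Y * c := by
    rw [sum_card_nb_comm]
    have h3 : ∀ y ∈ X, #(nb G y W₁) ≤ m + if y ∈ Y then c else 0 := by
      intro y hy
      by_cases h : y ∈ Y
      · simp only [h, if_true]
        have := card_le_card (nb_subset G y W₁)
        omega
      · simp only [h, if_false]
        simp only [hY, mem_filter, not_and, not_le] at h
        have := h hy
        omega
    refine (sum_le_sum h3).trans ?_
    rw [sum_add_distrib, sum_const, sum_ite_mem, sum_const, smul_eq_mul, smul_eq_mul]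
    have h4 : #X ≤ Fintype.card V := card_le_univ X
    have h5 : #(X ∩ Y) ≤ #Y := card_le_card inter_subset_right
    exact Nat.add_le_add (Nat.mul_le_mul_right _ h4) (Nat.mul_le_mul_right _ h5)
  have h3 : η / 2 * Fintype.card V ≤ #Y := by
    have h2' : ∑ x ∈ W₁, (#(nb G x X) : ℝ) ≤ Fintype.card V * m + #Y * c := by exact_mod_cast h2
    have h4 : (2 * m : ℝ) * Fintype.card V ≤ η * c * Fintype.card V :=
      mul_le_mul_of_nonneg_right hc2 (by positivity)
    have h5 : (c : ℝ) * (η / 2 * Fintype.card V) ≤ c * #Y := by linarith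
    exact le_of_mul_le_mul_left h5 hc1
  set R : Finset (Finset V) := {Q ∈ W₁.powerset | m ≤ #Q} with hR
  have hRc : (#R : ℝ) ≤ 2 ^ c := by
    have : #R ≤ 2 ^ c := by
      rw [← hW₁c, ← card_powerset]; exact card_le_card (filter_subset _ _)
    exact_mod_cast this
  obtain ⟨Q, hQ, hQc⟩ := exists_le_card_fiber_of_nsmul_le_card_of_maps_to
    (s := Y) (t := R) (f := fun y => nb G y W₁) (b := η / (2 * 2 ^ c) * Fintype.card V)
    (fun y hy => by
      simp only [hR, mem_filter, mem_powerset]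
      exact ⟨nb_subset _ _ _, (mem_filter.1 hy).2⟩)
    ⟨W₁, by simp [hR, hW₁c, hcm]⟩ (by
      rw [nsmul_eq_mul]
      refine le_trans ?_ h3
      calc (#R : ℝ) * (η / (2 * 2 ^ c) * Fintype.card V)
          ≤ 2 ^ c * (η / (2 * 2 ^ c) * Fintype.card V) :=
            mul_le_mul_of_nonneg_right hRc (by positivity)
        _ = η / 2 * Fintype.card V := by field_simp)
  simp only [hR, mem_filter, mem_powerset] at hQ
  obtain ⟨S, hS, hSc⟩ := exists_subset_card_eq hQ.2
  refine ⟨S, hS.trans (hQ.1.trans hW₁), hSc, hQc.trans (Nat.cast_le.2 (card_le_card ?_))⟩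
  intro y hy
  simp only [mem_filter] at hy ⊢
  refine ⟨(mem_filter.1 hy.1).1, fun s hs => ?_⟩
  have := hS hs
  rw [← hy.2, mem_nb] at this
  exact this.2.symm

/-- The classes are treated one at a time, thinning the set of vertices at each stage. The statement
is universal in `m` because the size needed for the remaining classes is the target for the current
one. -/
lemma exists_common_nb_family {η : ℝ} (hη : 0 < η) {p : ℕ} (J : Finset (Fin p)) :
    ∀ m : ℕ, ∃ c : ℕ, ∃ γ : ℝ, 0 < γ ∧ ∀ (V : Type) [Fintype V] (G : SimpleGraph V)
      (P : Fin p → Finset V) (W : Finset V),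
      c ≤ #W → (∀ w ∈ W, ∀ i, η * Fintype.card V ≤ #(nb G w (P i))) →
      ∃ S ⊆ W, #S = m ∧ ∀ j ∈ J, γ * Fintype.card V ≤ #{y ∈ P j | ∀ s ∈ S, G.Adj s y} := by
  induction J using Finset.induction_on with
  | empty =>
    refine fun m => ⟨m, 1, one_pos, fun V _ G P W hW _ => ?_⟩
    obtain ⟨S, hS, hSc⟩ := exists_subset_card_eq hW
    exact ⟨S, hS, hSc, by simp⟩
  | insert a J ha ih =>
    intro m
    obtain ⟨c₁, γ₁, hγ₁, h₁⟩ := ih m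
    obtain ⟨c₂, γ₂, hγ₂, h₂⟩ := exists_common_nb hη c₁
    refine ⟨c₂, min γ₁ γ₂, lt_min hγ₁ hγ₂, fun V _ G P W hW hnb => ?_⟩
    obtain ⟨S₁, hS₁, hS₁c, hS₁'⟩ := h₂ V G (P a) W hW fun w hw => hnb w hw a
    obtain ⟨S, hS, hSc, hS'⟩ := h₁ V G P S₁ hS₁c.ge fun w hw => hnb w (hS₁ hw)
    refine ⟨S, hS.trans hS₁, hSc, fun j hj => ?_⟩
    have hn : (0 : ℝ) ≤ Fintype.card V := by positivity
    rcases mem_insert.1 hj with rfl | hj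
    · refine (mul_le_mul_of_nonneg_right (min_le_right _ _) hn).trans
        (hS₁'.trans (Nat.cast_le.2 (card_le_card fun y hy => ?_)))
      simp only [mem_filter] at hy ⊢
      exact ⟨hy.1, fun s hs => hy.2 s (hS hs)⟩
    · exact (mul_le_mul_of_nonneg_right (min_le_left _ _) hn).trans (hS' j hj)

/-- Only boundedly many vertices have many neighbours in every class. -/
lemma exists_card_wide_le {η : ℝ} (hη : 0 < η) (p m : ℕ) :
    ∃ c : ℕ, ∃ γ : ℝ, 0 < γ ∧ ∀ (V : Type) [Fintype V] (G : SimpleGraph V)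
      (P : Fin p → Finset V) (ξ : ℝ), 0 ≤ ξ →
      (∀ i j, i ≠ j → ∀ x ∈ P i, (#{y ∈ P j | ¬ G.Adj x y} : ℝ) ≤ ξ) → NoBlowup G p m →
      p * m * (ξ + 1) < γ * Fintype.card V →
      #{x : V | ∀ i, η * Fintype.card V ≤ #(nb G x (P i))} ≤ c := by
  obtain ⟨c, γ, hγ, h⟩ := exists_common_nb_family hη (univ : Finset (Fin p)) m
  refine ⟨c, γ, hγ, fun V _ G P ξ hξ hP hfree hlt => ?_⟩
  by_contra! hcon
  obtain ⟨S, -, hSc, hS⟩ := h V G P _ hcon.le fun w hw => (mem_filter.1 hw).2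
  -- Too many wide vertices give `m` of them with linear common neighbourhoods in all classes;
  -- choosing `m` mutually joined common neighbours per class completes a forbidden `(p +
  -- 1)`-partite graph.
  obtain ⟨f, hf1, hf2, hf3⟩ := exists_transversal (ι := Fin p × Fin m) hξ hP Prod.fst
    (fun u => {y ∈ P u.1 | ∀ s ∈ S, G.Adj s y}) (fun u => filter_subset _ _) (by
      intro u
      refine lt_of_lt_of_le ?_ (hS u.1 (mem_univ _))
      simpa using hlt)
  have hSf : ∀ j, ∀ x ∈ S, ∀ y ∈ univ.image fun l => f (j, l), G.Adj x y := by
    intro j x hx y hy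
    simp only [mem_image, mem_univ, true_and] at hy
    obtain ⟨l, rfl⟩ := hy
    exact (mem_filter.1 (hf2 (j, l))).2 x hx
  obtain ⟨o, ho⟩ := hfree (fun o => o.elim S fun j => univ.image fun l => f (j, l)) (by
    rintro (_ | j) (_ | l) hjl x hx y hy
    · exact absurd rfl hjl
    · exact hSf l x hx y hy
    · exact (hSf j y hy x hx).symm
    · simp only [Option.elim_some, mem_image, mem_univ, true_and] at hx hy
      obtain ⟨a, rfl⟩ := hx
      obtain ⟨b, rfl⟩ := hy
      exact hf3 _ _ fun h => hjl (by simpa using h))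
  rcases o with _ | j
  · simp [hSc] at ho
  · simp only [Option.elim_some] at ho
    rw [card_image_of_injective _ (fun a b hab => by simpa using hf1 hab)] at ho
    simp at ho

/-- Vertices of `X` outside `Q` have all their neighbours in `X` within `Q`, so the sum is at most
twice the degrees collected at `Q`. -/
lemma sum_card_nb_le_of_cover {V : Type} {G : SimpleGraph V} {X Q : Finset V} {b : ℝ} (hb : 0 ≤ b)
    (hQ : ∀ x ∈ X, ∀ y ∈ X, G.Adj x y → x ∈ Q ∨ y ∈ Q)
    (hX : ∀ x ∈ X, (#(nb G x X) : ℝ) ≤ b) : ∑ x ∈ X, (#(nb G x X) : ℝ) ≤ 2 * #Q * b := by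
  have h1 : ∀ x ∈ X, (#(nb G x X) : ℝ) ≤ #(nb G x (X ∩ Q)) + if x ∈ Q then b else 0 := by
    intro x hx
    by_cases h : x ∈ Q
    · simp only [h, if_true]
      have := hX x hx
      have : (0 : ℝ) ≤ #(nb G x (X ∩ Q)) := by positivity
      linarith
    · simp only [h, if_false, add_zero]
      refine Nat.cast_le.2 (card_le_card fun y hy => ?_)
      rw [mem_nb] at hy ⊢
      exact ⟨mem_inter.2 ⟨hy.1, (hQ x hx y hy.1 hy.2).resolve_left h⟩, hy.2⟩
  have h2 := sum_le_sum h1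
  rw [sum_add_distrib, sum_ite_mem, sum_const, nsmul_eq_mul] at h2
  have h3 : ∑ x ∈ X, (#(nb G x (X ∩ Q)) : ℝ) = ∑ y ∈ X ∩ Q, (#(nb G y X) : ℝ) := by
    exact_mod_cast sum_card_nb_comm G X (X ∩ Q)
  have h4 := sum_le_card_nsmul (X ∩ Q) (fun y => (#(nb G y X) : ℝ)) b
    fun y hy => hX y (mem_inter.1 hy).1
  rw [nsmul_eq_mul] at h4
  have h5 : (#(X ∩ Q) : ℝ) ≤ #Q := Nat.cast_le.2 (card_le_card inter_subset_right)
  have h6 := mul_le_mul_of_nonneg_right h5 hb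
  linarith

/-- Edges at `W` are charged twice to `W`. Outside `W`, pairs of different colours contribute at
most the sum of `#(X i) * (m - #(X i))`, bounded by Cauchy–Schwarz; each colour class adds at most
`b`. -/
lemma sum_degree_le {V : Type} [Fintype V] {G : SimpleGraph V} {p : ℕ} (hp : 0 < p) (W : Finset V)
    (col : V → Fin p) (b : ℝ)
    (hb : ∀ i, ∑ x ∈ ({x | x ∉ W ∧ col x = i} : Finset V),
      (#(nb G x {x | x ∉ W ∧ col x = i}) : ℝ) ≤ b) :
    ∑ v, (G.degree v : ℝ) ≤ 2 * ∑ w ∈ W, (G.degree w : ℝ) +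
      (1 - 1 / p) * ((Fintype.card V : ℝ) - #W) ^ 2 + p * b := by
  set X : Fin p → Finset V := fun i => {x | x ∉ W ∧ col x = i} with hX
  set m : ℝ := (Fintype.card V : ℝ) - #W with hm
  have hWc : (#Wᶜ : ℝ) = m := by
    rw [card_compl, Nat.cast_sub (card_le_univ W)]
  have hXsub : ∀ i, X i ⊆ Wᶜ := fun i x hx => by
    simp only [hX, mem_filter, mem_univ, true_and] at hx; simpa using hx.1
  have hfib : ∀ F : V → ℝ, ∑ x ∈ Wᶜ, F x = ∑ i, ∑ x ∈ X i, F x := by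
    intro F
    rw [← sum_fiberwise_of_maps_to (s := Wᶜ) (t := univ) (g := col) (fun _ _ => mem_univ _)]
    refine sum_congr rfl fun i _ => sum_congr ?_ fun _ _ => rfl
    ext x; simp [hX]
  have h1 : ∑ v, (G.degree v : ℝ) = ∑ w ∈ W, (G.degree w : ℝ) + ∑ x ∈ Wᶜ, (G.degree x : ℝ) :=
    (sum_add_sum_compl W _).symm
  have h2 : ∀ x, (G.degree x : ℝ) ≤ #(nb G x W) + #(nb G x Wᶜ) := by
    intro x
    rw [← card_nb_univ]
    have : #(nb G x univ) ≤ #(nb G x W) + #(nb G x Wᶜ) := by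
      refine (card_le_card fun y hy => ?_).trans (card_union_le _ _)
      rw [mem_union, mem_nb, mem_nb]
      have := (mem_nb.1 hy).2
      by_cases h : y ∈ W <;> simp [h, this]
    exact_mod_cast this
  have h3 : ∑ x ∈ Wᶜ, (#(nb G x W) : ℝ) ≤ ∑ w ∈ W, (G.degree w : ℝ) := by
    have : ∑ x ∈ Wᶜ, #(nb G x W) ≤ ∑ w ∈ W, G.degree w := by
      rw [sum_card_nb_comm]
      refine sum_le_sum fun w _ => ?_
      rw [← card_nb_univ]
      exact card_le_card (filter_subset_filter _ (subset_univ _))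
    exact_mod_cast this
  have h4 : ∀ i, ∑ x ∈ X i, (#(nb G x Wᶜ) : ℝ) ≤ b + #(X i) * (m - #(X i)) := by
    intro i
    have h5 : ∀ x ∈ X i, (#(nb G x Wᶜ) : ℝ) ≤ #(nb G x (X i)) + (m - #(X i)) := by
      intro x _
      have h6 : #(nb G x Wᶜ) ≤ #(nb G x (X i)) + #(Wᶜ \ X i) := by
        refine (card_le_card fun y hy => ?_).trans (card_union_le _ _)
        rw [mem_nb] at hy
        rw [mem_union, mem_nb, mem_sdiff]
        by_cases h : y ∈ X i
        · exact Or.inl ⟨h, hy.2⟩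
        · exact Or.inr ⟨hy.1, h⟩
      have h7 := card_sdiff_add_card_eq_card (hXsub i)
      have h8 : (#(Wᶜ \ X i) : ℝ) + #(X i) = m := by rw [← hWc]; exact_mod_cast h7
      have h9 : (#(nb G x Wᶜ) : ℝ) ≤ #(nb G x (X i)) + #(Wᶜ \ X i) := by exact_mod_cast h6
      linarith
    have h6 := sum_le_sum h5
    rw [sum_add_distrib, sum_const, nsmul_eq_mul] at h6
    linarith [hb i]
  have h5 := sum_le_sum fun i (_ : i ∈ (univ : Finset (Fin p))) => h4 i
  rw [← hfib, sum_add_distrib, sum_const, card_univ, Fintype.card_fin, nsmul_eq_mul] at h5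
  have h6 : ∑ i, (#(X i) : ℝ) = m := by
    have := hfib fun _ => 1
    simp only [sum_const, nsmul_eq_mul, mul_one] at this
    rw [← this, hWc]
  have h7 : ∑ i, (#(X i) : ℝ) * (m - #(X i)) = m ^ 2 - ∑ i, (#(X i) : ℝ) ^ 2 := by
    have : ∀ i, (#(X i) : ℝ) * (m - #(X i)) = m * #(X i) - (#(X i) : ℝ) ^ 2 := fun i => by ring
    simp only [this]
    rw [sum_sub_distrib, ← mul_sum, h6]; ring
  have h8 : m ^ 2 / p ≤ ∑ i, (#(X i) : ℝ) ^ 2 := by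
    have h9 := sq_sum_le_card_mul_sum_sq (s := (univ : Finset (Fin p))) (f := fun i => (#(X i) : ℝ))
    rw [h6, card_univ, Fintype.card_fin] at h9
    rw [div_le_iff₀' (by exact_mod_cast hp)]
    exact h9
  have h9 := sum_le_sum fun x (_ : x ∈ Wᶜ) => h2 x
  rw [sum_add_distrib] at h9
  have h10 : (1 - 1 / (p : ℝ)) * m ^ 2 = m ^ 2 - m ^ 2 / p := by ring
  linarith

lemma card_sub_le_card_common {V : Type} {G : SimpleGraph V} (A Z : Finset V) {b : ℝ}
    (hZ : ∀ z ∈ Z, (#{y ∈ A | ¬ G.Adj z y} : ℝ) ≤ b) :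
    (#A : ℝ) - #Z * b ≤ #{y ∈ A | ∀ z ∈ Z, G.Adj z y} := by
  have hsub : A ⊆ {y ∈ A | ∀ z ∈ Z, G.Adj z y} ∪ Z.biUnion fun z => {y ∈ A | ¬ G.Adj z y} := by
    intro y hy
    by_cases h : ∀ z ∈ Z, G.Adj z y
    · exact mem_union_left _ (mem_filter.2 ⟨hy, h⟩)
    · push Not at h
      obtain ⟨z, hz, hzy⟩ := h
      exact mem_union_right _ (mem_biUnion.2 ⟨z, hz, mem_filter.2 ⟨hy, hzy⟩⟩)
  have h1 : #A ≤ #{y ∈ A | ∀ z ∈ Z, G.Adj z y} + ∑ z ∈ Z, #{y ∈ A | ¬ G.Adj z y} :=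
    (card_le_card hsub).trans ((card_union_le _ _).trans (Nat.add_le_add_left card_biUnion_le _))
  have h2 : (#A : ℝ) ≤ #{y ∈ A | ∀ z ∈ Z, G.Adj z y} + ∑ z ∈ Z, (#{y ∈ A | ¬ G.Adj z y} : ℝ) := by
    exact_mod_cast h1
  have h3 := sum_le_card_nsmul Z (fun z => (#{y ∈ A | ¬ G.Adj z y} : ℝ)) b hZ
  rw [nsmul_eq_mul] at h3
  linarith

/-! ### Consequences of a core -/

/-- The classes `P i` are nearly balanced, cover nearly everything, and are nearly completely joined
to each other; `G` has large minimum degree. -/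
structure Core {V : Type} [Fintype V] (G : SimpleGraph V) {p : ℕ} (P : Fin p → Finset V)
    (ε C : ℝ) : Prop where
  disj : ∀ i j, i ≠ j → Disjoint (P i) (P j)
  near : ∀ i j, i ≠ j → ∀ x ∈ P i, (#{y ∈ P j | ¬ G.Adj x y} : ℝ) ≤ ε * Fintype.card V
  upper : ∀ i, (#(P i) : ℝ) ≤ (1 / p + ε) * Fintype.card V
  total : (1 - ε) * Fintype.card V ≤ ∑ i, (#(P i) : ℝ)
  deg : ∀ v, (1 - 1 / p : ℝ) * Fintype.card V - C ≤ G.degree v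

namespace Core

variable {V : Type} [Fintype V] {G : SimpleGraph V} {p : ℕ} {P : Fin p → Finset V} {ε C : ℝ}

lemma lower (h : Core G P ε C) (hp : 0 < p) (i : Fin p) :
    (1 / p - p * ε) * Fintype.card V ≤ #(P i) := by
  have h0 := h.total
  have h1 := add_sum_erase univ (fun j => (#(P j) : ℝ)) (mem_univ i)
  have h2 := sum_le_card_nsmul (univ.erase i) (fun j => (#(P j) : ℝ)) _ fun j _ => h.upper j
  rw [card_erase_of_mem (mem_univ i), card_univ, Fintype.card_fin, nsmul_eq_mul,
    Nat.cast_sub (by omega)] at h2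
  have hp0 : (0 : ℝ) < p := by exact_mod_cast hp
  have h3 : ((p : ℝ) - (1 : ℕ)) * ((1 / p + ε) * Fintype.card V) =
      (1 - 1 / p + p * ε - ε) * Fintype.card V := by field_simp; push_cast; ring
  rw [h3] at h2
  linarith

/-- Missing nearly all of `P i` uses up the roughly `n/p` non-neighbours that the minimum degree
permits. -/
lemma card_not_adj_le (h : Core G P ε C) (hp : 0 < p) {η : ℝ} {x : V} {i j : Fin p} (hij : i ≠ j)
    (hx : (#(nb G x (P i)) : ℝ) < η * Fintype.card V) :
    (#{y ∈ P j | ¬ G.Adj x y} : ℝ) ≤ (p * ε + η) * Fintype.card V + C := by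
  have h2 := card_le_add_of_degree G x (P i ∪ P j)
  rw [card_union_of_disjoint (h.disj i j hij)] at h2
  have h3 : #(nb G x (P i ∪ P j)) ≤ #(nb G x (P i)) + #(nb G x (P j)) := by
    rw [nb, filter_union]; exact card_union_le _ _
  have h4 := card_nb_add_card_not G x (P j)
  have h6 : #(P i) + #{y ∈ P j | ¬ G.Adj x y} + G.degree x ≤
    #(nb G x (P i)) + Fintype.card V := by omega
  have h7 : (#(P i) : ℝ) + #{y ∈ P j | ¬ G.Adj x y} + G.degree x ≤
    #(nb G x (P i)) + Fintype.card V := by exact_mod_cast h6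
  linarith [h.deg x, h.lower hp i]

lemma card_outside_le (h : Core G P ε C) :
    (#{y : V | ∀ j, y ∉ P j} : ℝ) ≤ ε * Fintype.card V := by
  have h1 : #(univ.biUnion P) = ∑ j, #(P j) :=
    card_biUnion fun i _ j _ hij => h.disj i j hij
  have h2 : ({y : V | ∀ j, y ∉ P j} : Finset V) = (univ.biUnion P)ᶜ := by ext; simp
  have h3 : (#(univ.biUnion P)ᶜ : ℝ) = Fintype.card V - ∑ j, (#(P j) : ℝ) := by
    rw [card_compl, Nat.cast_sub (card_le_univ _), h1]; push_cast; rfl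
  rw [h2, h3]
  linarith [h.total]

/-- A neighbour of colour `i` cannot lie in another class `P j`, whose vertices see almost all of `P
i`. It lies in `P i`, where `x` has few neighbours, or in no class at all. -/
lemma card_nb_same_color_le (h : Core G P ε C) (hp : 0 < p) {η : ℝ}
    (hη : η ≤ 1 / p - (p + 1) * ε) {W : Finset V} {col : V → Fin p}
    (hcol : ∀ x ∉ W, (#(nb G x (P (col x))) : ℝ) < η * Fintype.card V) {i : Fin p} {x : V}
    (hx : x ∉ W) (hxi : col x = i) :
    (#(nb G x {y | y ∉ W ∧ col y = i}) : ℝ) ≤ (η + ε) * Fintype.card V := by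
  have hsub : nb G x {y | y ∉ W ∧ col y = i} ⊆ nb G x (P i) ∪
      ({y : V | ∀ j, y ∉ P j} : Finset V) := by
    intro y hy
    simp only [mem_nb, mem_filter, mem_univ, true_and] at hy
    obtain ⟨⟨hyW, hyi⟩, hxy⟩ := hy
    simp only [mem_union, mem_nb, mem_filter, mem_univ, true_and]
    by_contra! hcon
    obtain ⟨h1, j, hj⟩ := hcon
    have hji : j ≠ i := by
      rintro rfl; exact h1 hj hxy
    have h2 := h.near j i hji y hj
    have h3 := card_nb_add_card_not G y (P i)
    have h3' : (#(nb G y (P i)) : ℝ) + #{z ∈ P i | ¬ G.Adj y z} = #(P i) := by exact_mod_cast h3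
    have h4 := hcol y hyW
    rw [hyi] at h4
    have h5 := h.lower hp i
    have h6 : η * Fintype.card V ≤ (1 / p - (p + 1) * ε) * Fintype.card V :=
      mul_le_mul_of_nonneg_right hη (by positivity)
    linarith
  have h1 : (#(nb G x {y | y ∉ W ∧ col y = i}) : ℝ) ≤
      #(nb G x (P i)) + #{y : V | ∀ j, y ∉ P j} := by
    exact_mod_cast (card_le_card hsub).trans (card_union_le _ _)
  have h2 := hcol x hx
  rw [hxi] at h2
  linarith [h.card_outside_le]

/-- Inclusion–exclusion gives about `(1 - 2/p + θ) n` common neighbours. Dropping one class costs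
about `n/p`, and `1 - 3/p ≥ 0` leaves roughly `θ n` to spread over the other classes. This is
another use of `3 ≤ p`. -/
lemma exists_common (h : Core G P ε C) (hp : 3 ≤ p) {θ t : ℝ} (ht : 0 < t)
    (hθ : p * t ≤ (θ - 2 * ε) * Fintype.card V - C) {x y : V}
    (hxy : (2 - 2 / p + θ) * Fintype.card V - C ≤ (G.degree x : ℝ) + G.degree y) (a : Fin p) :
    ∃ b, b ≠ a ∧ t ≤ #{z ∈ P b | G.Adj x z ∧ G.Adj y z} := by
  by_contra! hcon
  set K : Finset V := {z : V | G.Adj x z ∧ G.Adj y z} with hK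
  have h1 : G.degree x + G.degree y ≤ #K + Fintype.card V := by
    rw [← card_nb_univ, ← card_nb_univ, ← card_inter_add_card_union]
    refine Nat.add_le_add (card_le_card fun z hz => ?_) (card_le_univ _)
    simp only [mem_inter, mem_nb, mem_univ, true_and] at hz
    simp [hK, hz]
  have hsub : K ⊆ ({z : V | ∀ j, z ∉ P j} : Finset V) ∪ P a ∪
      (univ.erase a).biUnion fun b => {z ∈ P b | G.Adj x z ∧ G.Adj y z} := by
    intro z hz
    simp only [hK, mem_filter, mem_univ, true_and] at hz
    simp only [mem_union, mem_filter, mem_univ, true_and, mem_biUnion, mem_erase]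
    by_cases h2 : ∀ j, z ∉ P j
    · exact Or.inl (Or.inl h2)
    · push Not at h2
      obtain ⟨j, hj⟩ := h2
      by_cases hja : j = a
      · subst hja; exact Or.inl (Or.inr hj)
      · exact Or.inr ⟨j, ⟨hja, trivial⟩, hj, hz⟩
  have h2 : #K ≤ #{z : V | ∀ j, z ∉ P j} + #(P a) +
      ∑ b ∈ univ.erase a, #{z ∈ P b | G.Adj x z ∧ G.Adj y z} := by
    refine (card_le_card hsub).trans ((card_union_le _ _).trans ?_)
    exact Nat.add_le_add (card_union_le _ _) card_biUnion_le
  have h3 : (#K : ℝ) ≤ #{z : V | ∀ j, z ∉ P j} + #(P a) +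
      ∑ b ∈ univ.erase a, (#{z ∈ P b | G.Adj x z ∧ G.Adj y z} : ℝ) := by exact_mod_cast h2
  have h4 := sum_le_card_nsmul (univ.erase a)
    (fun b => (#{z ∈ P b | G.Adj x z ∧ G.Adj y z} : ℝ)) t
    fun b hb => (hcon b (mem_erase.1 hb).1).le
  rw [card_erase_of_mem (mem_univ a), card_univ, Fintype.card_fin, nsmul_eq_mul,
    Nat.cast_sub (by omega)] at h4
  push_cast at h4
  have h5 : (G.degree x : ℝ) + G.degree y ≤ #K + Fintype.card V := by exact_mod_cast h1
  have h6 := h.upper a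
  have h7 := h.card_outside_le
  have h8 : (3 : ℝ) / p ≤ 1 := by
    rw [div_le_one (by positivity)]; exact_mod_cast hp
  have h9 : (3 : ℝ) / p * Fintype.card V ≤ 1 * Fintype.card V :=
    mul_le_mul_of_nonneg_right h8 (by positivity)
  have h10 : (2 - 2 / p + θ) * (Fintype.card V : ℝ) - (1 / p + ε) * Fintype.card V =
    2 * Fintype.card V - 3 / p * Fintype.card V + (θ - ε) * Fintype.card V := by ring
  linarith

end Core

/-! ### Deleting `#S` vertices to reach a `p`-colourable graph -/

/-- Two colours serve the vertices of `T`; the same `p - 1` further colours serve the new vertices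
of every clique. -/
lemma edgeBlowup_colorable {τ : Type} {T : SimpleGraph τ} (hT : T.Colorable 2) {p : ℕ}
    (hp : 1 ≤ p) : (edgeBlowup T (p + 1)).Colorable (p + 1) := by
  obtain ⟨d⟩ := hT
  refine ⟨Coloring.mk (Sum.elim (fun u => ⟨(d u).1, by omega⟩)
    fun a => ⟨a.2.1 + 2, by omega⟩) ?_⟩
  intro x y hxy
  rw [edgeBlowup_adj] at hxy
  obtain ⟨hne, e, h1, h2⟩ := hxy
  rcases x with u | ⟨f, i⟩ <;> rcases y with v | ⟨f', j⟩
  · rw [inl_mem_edgeClique] at h1 h2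
    have hne' : u ≠ v := fun h => hne (by rw [h])
    have : (e : Sym2 τ) = s(u, v) := ((Sym2.mem_and_mem_iff hne').1 ⟨h1, h2⟩)
    have h3 := e.2
    rw [this] at h3
    have h4 := d.valid h3
    simp only [Sum.elim_inl, ne_eq, Fin.mk.injEq]
    exact fun h => h4 (Fin.ext h)
  · simp only [Sum.elim_inl, Sum.elim_inr, ne_eq, Fin.mk.injEq]; omega
  · simp only [Sum.elim_inl, Sum.elim_inr, ne_eq, Fin.mk.injEq]; omega
  · rw [inr_mem_edgeClique] at h1 h2
    subst h1
    subst h2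
    simp only [Sum.elim_inr, ne_eq, Fin.mk.injEq]
    intro h
    exact hne (by rw [Fin.ext (show i.1 = j.1 by omega)])

lemma noBlowup_of_free {U V : Type} [Fintype U] {F : SimpleGraph U} {G : SimpleGraph V} {p : ℕ}
    (hF : F.Colorable (p + 1)) (hfree : F.Free G) : NoBlowup G p (Fintype.card U) := by
  intro B hB
  by_contra! h
  obtain ⟨c⟩ := hF
  exact hfree (isContained_of_completeFamily
    ((Embedding.completeGraph (finSuccEquiv p).toEmbedding).toHom.comp c) hB h)

/-- The final `W` is the set of all wide vertices. The bound `η` keeps the edges inside colour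
classes negligible, `θ` marks a degree clearly above `(1 - 1/p) n` while `c` vertices below the mark
contribute less than `n/(4p)` in total, and `κ` dominates all remaining errors. -/
lemma exists_partition_of_core {τ V : Type} [Fintype τ] [Fintype V] {T : SimpleGraph τ}
    {S : Finset τ} {u₀ v₀ : τ} (hT : NearCover T S u₀ v₀) (hT2 : T.Colorable 2)
    {G : SimpleGraph V} {p : ℕ} {P : Fin p → Finset V} {ε C κ η θ L : ℝ} {c : ℕ} (hp : 3 ≤ p)
    (hfree : (edgeBlowup T (p + 1)).Free G) (h : Core G P ε C) (hε : 0 ≤ ε)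
    (hn : 0 < Fintype.card V) (hκ : 0 < κ) (hκη : κ ≤ η) (hκθ : κ ≤ θ)
    (hη : 32 * p ^ 2 * Fintype.card T.edgeSet * η = 1) (hθ : 4 * p * (c + 1) * θ = 1)
    (hεκ : p * ε ≤ κ / 64)
    (hL : Fintype.card (τ ⊕ T.edgeSet × Fin (p + 1 - 2)) * (ε * Fintype.card V + 2) ≤ L)
    (hLκ : 32 * p * L ≤ κ * Fintype.card V) (hCκ : 64 * p * C ≤ κ * Fintype.card V)
    (hcκ : 64 * p * (c : ℝ) ^ 2 ≤ κ * Fintype.card V)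
    (hW : #{x : V | ∀ i, η * Fintype.card V ≤ #(nb G x (P i))} ≤ c)
    (hsum : (1 - 1 / p : ℝ) * (Fintype.card V : ℝ) ^ 2 + 2 * #S * (Fintype.card V / p) - C ≤
      ∑ v, (G.degree v : ℝ)) :
    ∃ W : Finset V, #W = #S ∧ ∃ col : V → Fin p, ∀ x ∉ W, ∀ y ∉ W, G.Adj x y → col x ≠ col y := by
  set W : Finset V := {x : V | ∀ i, η * Fintype.card V ≤ #(nb G x (P i))} with hWdef
  have hV : Nonempty V := Fintype.card_pos_iff.1 hn
  set n : ℝ := (Fintype.card V : ℝ) with hnr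
  set μ : ℕ := Fintype.card T.edgeSet with hμ
  set r : ℝ := n / p with hr
  have hn0 : 0 < n := by rw [hnr]; exact_mod_cast hn
  have hp0 : (0 : ℝ) < p := by positivity
  have hp3 : (3 : ℝ) ≤ p := by exact_mod_cast hp
  have hr0 : 0 < r := by positivity
  have hpr : p * r = n := by rw [hr]; field_simp
  have h1p : (1 / p : ℝ) * n = r := by rw [hr]; ring
  have hμ1 : (1 : ℝ) ≤ μ := by
    have : 0 < μ := Fintype.card_pos_iff.2 ⟨⟨s(u₀, v₀), hT.adj⟩⟩
    exact_mod_cast this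
  have hη0 : 0 < η := hκ.trans_le hκη
  have hθ0 : 0 < θ := hκ.trans_le hκθ
  have hηn : 0 < η * n := by positivity
  have hκn : 0 < κ * n := by positivity
  have hκηn : κ * n ≤ η * n := mul_le_mul_of_nonneg_right hκη hn0.le
  have hκθn : κ * n ≤ θ * n := mul_le_mul_of_nonneg_right hκθ hn0.le
  -- numerical consequences
  have e1 : 32 * (p * μ * (η * n)) = r := by
    have : p * (32 * (p * μ * (η * n))) = p * r := by
      rw [hpr]; linear_combination n * hη
    exact mul_left_cancel₀ hp0.ne' this
  have e2 : 96 * (μ * (η * n)) ≤ r := by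
    have : 3 * (μ * (η * n)) ≤ p * (μ * (η * n)) :=
      mul_le_mul_of_nonneg_right hp3 (by positivity)
    linarith
  have e3 : 96 * (η * n) ≤ r := by
    have : 1 * (η * n) ≤ μ * (η * n) := mul_le_mul_of_nonneg_right hμ1 hηn.le
    linarith
  have e4 : 4 * ((c + 1) * (θ * n)) = r := by
    have : p * (4 * ((c + 1) * (θ * n))) = p * r := by
      rw [hpr]; linear_combination n * hθ
    exact mul_left_cancel₀ hp0.ne' this
  have e5 : 64 * (p * ε * n) ≤ κ * n := by nlinarith
  have e6 : 192 * (ε * n) ≤ κ * n := by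
    have : 3 * (ε * n) ≤ p * (ε * n) := mul_le_mul_of_nonneg_right hp3 (by positivity)
    linarith
  have hL0 : 0 ≤ L := le_trans (by positivity) hL
  have e7 : 96 * L ≤ κ * n := by
    have : 3 * L ≤ p * L := mul_le_mul_of_nonneg_right hp3 hL0
    linarith
  have e8 : 192 * C ≤ κ * n := by
    by_cases hC : 0 ≤ C
    · have : 3 * C ≤ p * C := mul_le_mul_of_nonneg_right hp3 hC
      linarith
    · linarith
  have e9 : 192 * (c : ℝ) ^ 2 ≤ κ * n := by
    have : 3 * (c : ℝ) ^ 2 ≤ p * (c : ℝ) ^ 2 := mul_le_mul_of_nonneg_right hp3 (by positivity)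
    linarith
  have hlow : ∀ i, 15 / 16 * r ≤ #(P i) := by
    intro i
    have h1 := h.lower (by omega) i
    have h2 : (1 / p - p * ε) * (Fintype.card V : ℝ) = r - p * ε * n := by rw [← h1p]; ring
    linarith
  have hcol : ∀ x, ∃ i, x ∉ W → (#(nb G x (P i)) : ℝ) < η * n := by
    intro x
    by_cases hx : x ∈ W
    · exact ⟨⟨0, by omega⟩, fun h => absurd hx h⟩
    · have h1 := hx
      simp only [hWdef, mem_filter, mem_univ, true_and, not_forall, not_le] at h1
      obtain ⟨i, hi⟩ := h1
      exact ⟨i, fun _ => hi⟩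
  choose col hcol using hcol
  have hnot : ∀ x ∉ W, ∀ j, col x ≠ j → (#{y ∈ P j | ¬ G.Adj x y} : ℝ) ≤ 2 * (η * n) := by
    intro x hx j hj
    have h1 := h.card_not_adj_le (by omega) hj (hcol x hx)
    have h2 : (p * ε + η) * (Fintype.card V : ℝ) + C = p * ε * n + η * n + C := by ring
    linarith
  have hξ : 0 ≤ ε * n := by positivity
  -- few edges inside the classes
  have hη' : η ≤ 1 / p - (p + 1) * ε := by
    have h1 : η * n ≤ (1 / p - (p + 1) * ε) * n := by
      have : (1 / p - (p + 1) * ε) * n = r - p * ε * n - ε * n := by rw [← h1p]; ring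
      linarith
    exact le_of_mul_le_mul_right h1 hn0
  have hinner : ∀ i, ∑ x ∈ ({x | x ∉ W ∧ col x = i} : Finset V),
      (#(nb G x {x | x ∉ W ∧ col x = i}) : ℝ) ≤ 8 * (μ * (η * n)) := by
    intro i
    set X : Finset V := {x | x ∉ W ∧ col x = i} with hX
    have hXm : ∀ x ∈ X, x ∉ W ∧ col x = i := fun x hx => by simpa [hX] using hx
    rcases exists_matching_or_cover G X μ with ⟨q, hq1, hq2⟩ | ⟨Q, hQ1, hQ2⟩
    · exfalso
      let φ := Fintype.equivFin T.edgeSet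
      refine hfree (isContained_of_matching hT2 hp hξ h.near hL i (fun e => q (φ e)) ?_ ?_ ?_)
      · intro e f a ha b hb hab
        obtain ⟨h1, h2⟩ := hq1 _ (φ e).2 _ (φ f).2 a ha b hb hab
        exact ⟨φ.injective (Fin.ext h1), h2⟩
      · intro e; exact (hq2 _ (φ e).2).2
      · intro a ha
        let Z : Finset V := (univ ×ˢ range 2).image fun x : T.edgeSet × ℕ => q (φ x.1) x.2
        have hZc : #Z ≤ 2 * μ := by
          refine card_image_le.trans ?_
          simp [hμ, mul_comm]
        have h1 := card_sub_le_card_common (G := G) (P a) Z (b := 2 * (η * n)) (by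
          intro z hz
          simp only [Z, mem_image, mem_product, mem_univ, true_and, mem_range, Prod.exists] at hz
          obtain ⟨e, b, hb, rfl⟩ := hz
          obtain ⟨h2, h3⟩ := hXm _ ((hq2 _ (φ e).2).1 b hb)
          exact hnot _ h2 a (by rw [h3]; exact ha.symm))
        have h2 : (#Z : ℝ) * (2 * (η * n)) ≤ 2 * μ * (2 * (η * n)) :=
          mul_le_mul_of_nonneg_right (by exact_mod_cast hZc) (by positivity)
        refine lt_of_lt_of_le ?_ (h1.trans (Nat.cast_le.2 (card_le_card fun y hy => ?_)))
        · have := hlow a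
          linarith
        · simp only [mem_filter] at hy ⊢
          refine ⟨hy.1, fun e j hj => hy.2 _ (mem_image.2 ⟨(e, j), by simp [hj], rfl⟩)⟩
    · have h1 := sum_card_nb_le_of_cover (b := 2 * (η * n)) (by positivity) hQ2 (by
        intro x hx
        have h2 := h.card_nb_same_color_le (by omega) hη' hcol (hXm x hx).1 (hXm x hx).2
        have h3 : (η + ε) * (Fintype.card V : ℝ) = η * n + ε * n := by ring
        linarith)
      have h2 : (#Q : ℝ) * (2 * (η * n)) ≤ 2 * μ * (2 * (η * n)) :=
        mul_le_mul_of_nonneg_right (by exact_mod_cast hQ1) (by positivity)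
      linarith
  -- total excess of the exceptional vertices
  have hexc : #S * r - r / 4 ≤ ∑ w ∈ W, ((G.degree w : ℝ) - (n - r)) := by
    have h1 := sum_degree_le (G := G) (by omega : 0 < p) W col _ hinner
    have h2 : (1 - 1 / p : ℝ) * (n - #W) ^ 2 ≤
        (1 - 1 / p : ℝ) * n ^ 2 - 2 * #W * (n - r) + (#W : ℝ) ^ 2 := by
      have : (1 - 1 / p : ℝ) * (n - #W) ^ 2 = (1 - 1 / p : ℝ) * n ^ 2 - 2 * #W * (n - 1 / p * n) +
        (#W : ℝ) ^ 2 - 1 / p * (#W : ℝ) ^ 2 := by ring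
      rw [this, h1p]
      have : 0 ≤ 1 / p * (#W : ℝ) ^ 2 := by positivity
      linarith
    have h3 : (#W : ℝ) ^ 2 ≤ (c : ℝ) ^ 2 := by
      have : (#W : ℝ) ≤ c := by exact_mod_cast hW
      gcongr
    rw [sum_sub_distrib, sum_const, nsmul_eq_mul]
    linarith
  set W' : Finset V := {w ∈ W | n - r + θ * n ≤ G.degree w} with hW'
  have hdegn : ∀ w, (G.degree w : ℝ) ≤ n := fun w => by
    rw [hnr, ← card_nb_univ]; exact_mod_cast card_le_univ _
  have hW'c : #S ≤ #W' := by
    -- A vertex has excess at most `r = n/p`, and one outside `W'` less than `θ * n`. The latter sum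
    -- to at most `r / 4`, so fewer than `#S` vertices in `W'` could not reach the total excess.
    have h1 : ∀ w ∈ W, (G.degree w : ℝ) - (n - r) ≤ (if w ∈ W' then r else 0) + θ * n := by
      intro w hw
      by_cases h2 : w ∈ W'
      · simp only [h2, if_true]
        have := hdegn w
        have : 0 < θ * n := by positivity
        linarith
      · simp only [h2, if_false]
        have h3 : ¬ (n - r + θ * n ≤ G.degree w) := fun h3 => h2 (mem_filter.2 ⟨hw, h3⟩)
        linarith
    have h2 := hexc.trans (sum_le_sum h1)
    rw [sum_add_distrib, sum_ite_mem, sum_const, sum_const, nsmul_eq_mul, nsmul_eq_mul,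
      inter_eq_right.2 (filter_subset _ _)] at h2
    have h3 : (#W : ℝ) * (θ * n) ≤ (c + 1) * (θ * n) := by
      have : (#W : ℝ) ≤ c := by exact_mod_cast hW
      exact mul_le_mul_of_nonneg_right (by linarith) (by positivity)
    by_contra! hlt
    have h4 : (#W' : ℝ) + 1 ≤ #S := by exact_mod_cast hlt
    have h5 := mul_le_mul_of_nonneg_right h4 hr0.le
    linarith
  obtain ⟨S', hSfilter, hScard⟩ := exists_subset_card_eq hW'c
  have hSsub : S' ⊆ W := hSfilter.trans (filter_subset _ _)
  obtain ⟨ψ, hψ1, hψ2⟩ := exists_injOn_mapsTo S S' hScard.ge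
  have hψW : ∀ s ∈ S, ψ s ∈ W := fun s hs => hSsub (hψ2 s hs)
  have hψdeg : ∀ s ∈ S, n - r + θ * n ≤ G.degree (ψ s) := fun s hs =>
    (mem_filter.1 (hSfilter (hψ2 s hs))).2
  have hWnb : ∀ x ∈ W, ∀ a, L < #(nb G x (P a)) := by
    intro x hx a
    have h1 := (mem_filter.1 hx).2 a
    linarith
  have hcommon : ∀ s ∈ S, ∀ x, ∀ a, ∃ b, b ≠ a ∧
      L < #{z ∈ P b | G.Adj (ψ s) z ∧ G.Adj x z} := by
    intro s hs x a
    have ht : p * (θ * n / (2 * p)) = θ * n / 2 := by field_simp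
    have hLt : L < θ * n / (2 * p) := by
      have : p * L < p * (θ * n / (2 * p)) := by rw [ht]; linarith
      exact lt_of_mul_lt_mul_left this hp0.le
    obtain ⟨b, hb, hb'⟩ := h.exists_common hp (θ := θ) (t := θ * n / (2 * p)) (x := ψ s) (y := x)
      (by positivity) (by
        have : (θ - 2 * ε) * (Fintype.card V : ℝ) = θ * n - 2 * (ε * n) := by ring
        rw [this, ht]; linarith) (by
        have h1 := hψdeg s hs
        have h2 := h.deg x
        have h3 : (2 - 2 / p + θ) * (Fintype.card V : ℝ) = 2 * n - 2 * (1 / p * n) + θ * n := by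
          ring
        have h4 : (1 - 1 / p : ℝ) * (Fintype.card V : ℝ) = n - 1 / p * n := by ring
        rw [h4] at h2
        rw [h3]
        linarith) a
    exact ⟨b, hb, hLt.trans_le hb'⟩
  have hpair : ∀ s ∈ S, ∀ s' ∈ S, ∃ a, L < #{y ∈ P a | G.Adj (ψ s) y ∧ G.Adj (ψ s') y} := by
    intro s hs s' _
    obtain ⟨b, -, hb⟩ := hcommon s hs (ψ s') ⟨0, by omega⟩
    exact ⟨b, hb⟩
  -- there are no further exceptional vertices
  have hWS : W = S' := by
    refine Subset.antisymm (fun x hx => ?_) hSsub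
    by_contra hxS
    -- The surplus wide vertex `x` becomes one new vertex of the exceptional clique (`g = 1`). It
    -- saves one colour there, so the `p` classes suffice for the other `p` vertices.
    refine hfree (hT.isContained (by omega) hξ h.near hL ψ hψ1 1 (by omega) univ (by simp)
      (fun _ => x) (by omega) ?_ (by omega) (fun s hs => hWnb _ (hψW s hs)) hpair ?_ ?_)
    · intro i _ u hu hxu
      exact hxS (hxu ▸ hψ2 u hu)
    · intro a _
      refine lt_of_lt_of_le (hWnb x hx a) (Nat.cast_le.2 (card_le_card fun y hy => ?_))
      rw [mem_nb] at hy
      exact mem_filter.2 ⟨hy.1, fun _ _ => hy.2⟩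
    · intro s hs s' hs'
      obtain ⟨a, -, ha⟩ := hcommon s hs x ⟨0, by omega⟩
      obtain ⟨b, hb, hb'⟩ := hcommon s' hs' x a
      refine ⟨a, mem_univ _, b, mem_univ _, hb.symm, ?_, ?_⟩
      · refine lt_of_lt_of_le ha (Nat.cast_le.2 (card_le_card fun y hy => ?_))
        simp only [mem_filter] at hy ⊢
        exact ⟨hy.1, hy.2.1, fun _ _ => hy.2.2⟩
      · refine lt_of_lt_of_le hb' (Nat.cast_le.2 (card_le_card fun y hy => ?_))
        simp only [mem_filter] at hy ⊢
        exact ⟨hy.1, hy.2.1, fun _ _ => hy.2.2⟩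
  have hWc : #W = #S := by rw [hWS, hScard]
  -- Now that `#W = #S`, each vertex must supply almost its full share: the others give at most `r`
  -- each, so `w` has excess at least `3r/4`.
  have hWdeg : ∀ w ∈ W, n - r / 4 ≤ G.degree w := by
    intro w hw
    have h1 := add_sum_erase W (fun w => (G.degree w : ℝ) - (n - r)) hw
    have h2 := sum_le_card_nsmul (W.erase w) (fun w => (G.degree w : ℝ) - (n - r)) r
      fun v _ => by linarith [hdegn v]
    have h3 := card_erase_add_one hw
    have h4 : (#(W.erase w) : ℝ) + 1 = #S := by rw [← hWc]; exact_mod_cast h3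
    rw [nsmul_eq_mul, show (#(W.erase w) : ℝ) = #S - 1 by linarith] at h2
    linarith
  have hWnot : ∀ w ∈ W, ∀ a, (#{y ∈ P a | ¬ G.Adj w y} : ℝ) ≤ r / 4 := by
    intro w hw a
    have h1 := card_le_add_of_degree G w (P a)
    have h2 := card_nb_add_card_not G w (P a)
    have h3 : #{y ∈ P a | ¬ G.Adj w y} + G.degree w ≤ Fintype.card V := by omega
    have h4 : (#{y ∈ P a | ¬ G.Adj w y} : ℝ) + G.degree w ≤ n := by rw [hnr]; exact_mod_cast h3
    linarith [hWdeg w hw]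
  -- there are no edges inside the classes
  refine ⟨W, hWc, col, fun x hx y hy hxy hc => ?_⟩
  let q : ℕ → V := fun j => if j = 0 then x else y
  have hqW : ∀ j, q j ∉ W := fun j => by simp only [q]; split_ifs <;> assumption
  have hqc : ∀ j, col (q j) = col x := fun j => by
    simp only [q]; split_ifs <;> simp [hc]
  -- Each of the three vertices misses at most `r / 4` of `P a`, which has at least `15r/16`
  -- vertices, so at least `3r/16` remain.
  have hkey : ∀ s ∈ S, ∀ a, a ≠ col x →
      L < #{z ∈ P a | G.Adj (ψ s) z ∧ ∀ j < 2, G.Adj (q j) z} := by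
    intro s hs a ha
    have h1 := card_sub_le_card_common (G := G) (P a) {ψ s, q 0, q 1} (b := r / 4) (by
      intro z hz
      simp only [mem_insert, mem_singleton] at hz
      have hq : ∀ j, (#{y ∈ P a | ¬ G.Adj (q j) y} : ℝ) ≤ r / 4 := fun j => by
        have := hnot _ (hqW j) a (by rw [hqc j]; exact ha.symm)
        linarith
      rcases hz with rfl | rfl | rfl
      exacts [hWnot _ (hψW s hs) a, hq 0, hq 1])
    have h2 : (#({ψ s, q 0, q 1} : Finset V) : ℝ) ≤ 3 := by exact_mod_cast card_le_three
    have h3 : (#({ψ s, q 0, q 1} : Finset V) : ℝ) * (r / 4) ≤ 3 * (r / 4) :=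
      mul_le_mul_of_nonneg_right h2 (by positivity)
    refine lt_of_lt_of_le ?_ (h1.trans (Nat.cast_le.2 (card_le_card fun z hz => ?_)))
    · linarith [hlow a]
    · simp only [mem_filter, mem_insert, mem_singleton, forall_eq_or_imp, forall_eq] at hz ⊢
      refine ⟨hz.1, hz.2.1, fun j hj => ?_⟩
      have : j = 0 ∨ j = 1 := by omega
      rcases this with rfl | rfl
      exacts [hz.2.2.1, hz.2.2.2]
  have hq01 : ∀ i < 2, ∀ j < 2, i ≠ j → G.Adj (q i) (q j) := by
    intro i hi j hj hij
    have : (i = 0 ∧ j = 1) ∨ (i = 1 ∧ j = 0) := by omega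
    rcases this with ⟨rfl, rfl⟩ | ⟨rfl, rfl⟩
    · simpa [q] using hxy
    · simpa [q] using hxy.symm
  have hab : ∃ a b : Fin p, a ≠ col x ∧ b ≠ col x ∧ a ≠ b := by
    have : 1 < #((univ : Finset (Fin p)).erase (col x)) := by
      rw [card_erase_of_mem (mem_univ _), card_univ, Fintype.card_fin]; omega
    obtain ⟨a, ha, b, hb, hab⟩ := one_lt_card.1 this
    exact ⟨a, b, (mem_erase.1 ha).1, (mem_erase.1 hb).1, hab⟩
  obtain ⟨a, b, ha, hb, hab⟩ := hab
  -- Both ends of the offending edge are new vertices of the exceptional clique (`g = 2`); its other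
  -- `p - 1` vertices take the classes different from `col x`.
  refine hfree (hT.isContained (by omega) hξ h.near hL ψ hψ1 2 (by omega) (univ.erase (col x)) ?_
    q ?_ ?_ hq01 (fun s hs => hWnb _ (hψW s hs)) hpair ?_ ?_)
  · rw [card_erase_of_mem (mem_univ _), card_univ, Fintype.card_fin]; omega
  · intro i hi j hj hij
    by_contra hne
    exact (hq01 i hi j hj hne).ne hij
  · intro i _ u hu hqu
    exact hqW i (hqu ▸ hψW u hu)
  · intro a ha
    obtain ⟨s, hs, -⟩ := hT.exists_left
    refine lt_of_lt_of_le (hkey s hs a (mem_erase.1 ha).1) (Nat.cast_le.2 (card_le_card fun z hz => ?_))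
    simp only [mem_filter] at hz ⊢
    exact ⟨hz.1, hz.2.2⟩
  · intro s hs s' hs'
    exact ⟨a, mem_erase.2 ⟨ha, mem_univ _⟩, b, mem_erase.2 ⟨hb, mem_univ _⟩, hab,
      by convert hkey s hs a ha, by convert hkey s' hs' b hb⟩

/-- A dense graph of large minimum degree without the edge blow-up of `T` becomes `p`-colourable
after deletion of `#S` vertices, where `S` is a near cover of `T`. -/
theorem exists_partition {τ : Type} [Fintype τ] {T : SimpleGraph τ} {S : Finset τ} {u₀ v₀ : τ}
    (hT : NearCover T S u₀ v₀) (hT2 : T.Colorable 2) {p : ℕ} (hp : 3 ≤ p) {C : ℝ} (hC : 0 ≤ C) :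
    ∃ N : ℕ, ∀ (V : Type) [Fintype V] (G : SimpleGraph V), N ≤ Fintype.card V →
      (∀ v, (1 - 1 / p : ℝ) * Fintype.card V - C ≤ G.degree v) →
      (edgeBlowup T (p + 1)).Free G →
      (1 - 1 / p : ℝ) * (Fintype.card V : ℝ) ^ 2 + 2 * #S * (Fintype.card V / p) - C ≤
        ∑ v, (G.degree v : ℝ) →
      ∃ W : Finset V, #W = #S ∧
        ∃ col : V → Fin p, ∀ x ∉ W, ∀ y ∉ W, G.Adj x y → col x ≠ col y := by
  have hp0 : (0 : ℝ) < p := by positivity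
  have hμ : 0 < Fintype.card T.edgeSet := Fintype.card_pos_iff.2 ⟨⟨s(u₀, v₀), hT.adj⟩⟩
  set f : ℕ := Fintype.card (τ ⊕ T.edgeSet × Fin (p + 1 - 2)) with hf
  have hf0 : 0 < f := Fintype.card_pos_iff.2 ⟨Sum.inl u₀⟩
  have hμ' : (0 : ℝ) < Fintype.card T.edgeSet := by exact_mod_cast hμ
  have hf' : (0 : ℝ) < f := by exact_mod_cast hf0
  set η : ℝ := 1 / (32 * p ^ 2 * Fintype.card T.edgeSet) with hη
  have hη0 : 0 < η := by positivity
  obtain ⟨c, γ, hγ, hc⟩ := exists_card_wide_le hη0 p f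
  set θ : ℝ := 1 / (4 * p * (c + 1)) with hθ
  have hθ0 : 0 < θ := by positivity
  set κ : ℝ := min γ (min η θ) with hκ
  have hκ0 : 0 < κ := lt_min hγ (lt_min hη0 hθ0)
  -- The core precision is fixed last, since `c` and `γ` depend on `η`, and `θ` on `c`. The factor
  -- `f`, the order of the blow-up, keeps the greedy embedding cost `f * (ε * n + 2)` below `κ * n /
  -- (32 * p)` for large `n`.
  set ε : ℝ := κ / (64 * p * f * (p + 1)) with hε
  have hε0 : 0 < ε := by positivity
  obtain ⟨N₁, hN₁⟩ := exists_core p f (by omega) hf0 C hC hε0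
  obtain ⟨N₂, hN₂⟩ := exists_nat_mul_ge (64 * p * (p * f + 2 * f + C + c ^ 2)) hκ0
  refine ⟨max 1 (max N₁ N₂), fun V _ G hn hdeg hfree hsum => ?_⟩
  have hblow := noBlowup_of_free (edgeBlowup_colorable hT2 (by omega)) hfree
  obtain ⟨P, h1, h2, h3, h4⟩ := hN₁ V G (by omega) hdeg hblow
  have hD := hN₂ (Fintype.card V) (by omega)
  have hn0 : (0 : ℝ) < Fintype.card V := by exact_mod_cast (by omega : 0 < Fintype.card V)
  set n : ℝ := (Fintype.card V : ℝ) with hnr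
  have hp1 : (1 : ℝ) ≤ p := by exact_mod_cast (by omega : 1 ≤ p)
  have hf1 : (1 : ℝ) ≤ f := by exact_mod_cast hf0
  have hεeq : 64 * (p * f * (p + 1) * ε) = κ := by rw [hε]; field_simp
  have hεn : 64 * (p * f * (p + 1) * (ε * n)) = κ * n := by rw [← hεeq]; ring
  have hκn : 0 < κ * n := by positivity
  have hpf : (0 : ℝ) ≤ p * f := by positivity
  have hc2 : (0 : ℝ) ≤ (c : ℝ) ^ 2 := by positivity
  have b1 : 64 * (p * f * (ε * n)) ≤ κ * n := by
    rw [← hεn]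
    have : p * f * (ε * n) * 1 ≤ p * f * (ε * n) * (p + 1) :=
      mul_le_mul_of_nonneg_left (by linarith) (by positivity)
    linarith
  have b2 : ∀ a : ℝ, 0 ≤ a → a ≤ p * f + 2 * f + C + c ^ 2 → 64 * (p * a) ≤ κ * n := by
    intro a _ h
    have := mul_le_mul_of_nonneg_left h hp0.le
    linarith
  have hκγ : κ * n ≤ γ * n := mul_le_mul_of_nonneg_right (min_le_left _ _) hn0.le
  have hwide := hc V G P (ε * n) (by positivity) h2 hblow (by
    have h5 := b2 (p * f) hpf (by linarith)
    have h6 : (1 : ℝ) * (p * f) ≤ p * (p * f) := mul_le_mul_of_nonneg_right hp1 hpf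
    have h7 : (p * f * (ε * n + 1) : ℝ) = p * f * (ε * n) + p * f := by ring
    linarith)
  refine exists_partition_of_core hT hT2 (κ := κ) (η := η) (θ := θ) (c := c)
    (L := f * (ε * n + 2)) hp hfree ⟨h1, h2, h3, h4, hdeg⟩ hε0.le (by omega) hκ0
    ((min_le_right _ _).trans (min_le_left _ _)) ((min_le_right _ _).trans (min_le_right _ _))
    ?_ ?_ ?_ le_rfl ?_ ?_ ?_ hwide hsum
  · rw [hη]; field_simp
  · rw [hθ]; field_simp
  · have h5 : (p : ℝ) * ε * 1 ≤ p * ε * (f * (p + 1)) :=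
      mul_le_mul_of_nonneg_left (by nlinarith) (by positivity)
    linarith
  · have h5 := b2 (2 * f) (by positivity) (by linarith)
    linarith
  · have h5 := b2 C hC (by linarith)
    linarith
  · have h5 := b2 ((c : ℝ) ^ 2) hc2 (by linarith)
    linarith

/-! ### Edge counts of joins, Turán graphs and `graphH` -/

/-- The number of edges. -/
noncomputable def numE {V : Type} (G : SimpleGraph V) : ℕ := Nat.card G.edgeSet

lemma card_edgeFinset_eq_numE {V : Type} (G : SimpleGraph V) [Fintype G.edgeSet] :
    #G.edgeFinset = numE G := by
  rw [edgeFinset_card, numE, Nat.card_eq_fintype_card]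

lemma numE_congr {V W : Type} {G : SimpleGraph V} {H : SimpleGraph W} (f : G ≃g H) :
    numE G = numE H := Nat.card_congr f.mapEdgeSet

lemma two_mul_numE {V : Type} [Fintype V] (G : SimpleGraph V) :
    2 * numE G = ∑ v, G.degree v := by
  rw [sum_degrees_eq_twice_card_edges, card_edgeFinset_eq_numE]

section Join

variable {V W : Type} {G : SimpleGraph V} {H : SimpleGraph W}

@[simp] lemma join_adj_inl_inl {v w : V} : (join G H).Adj (.inl v) (.inl w) ↔ G.Adj v w := by
  simp [join]

@[simp] lemma join_adj_inr_inr {v w : W} : (join G H).Adj (.inr v) (.inr w) ↔ H.Adj v w := by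
  simp [join]

@[simp] lemma join_adj_inl_inr {v : V} {w : W} : (join G H).Adj (.inl v) (.inr w) := by
  simp [join]

@[simp] lemma join_adj_inr_inl {v : V} {w : W} : (join G H).Adj (.inr w) (.inl v) := by
  simp [join]

lemma numE_join [Fintype V] [Fintype W] :
    numE (join G H) = numE G + numE H + Fintype.card V * Fintype.card W := by
  have hd : ∀ {X : Type} [Fintype X] (K : SimpleGraph X),
      2 * numE K = ∑ x, ∑ y, if K.Adj x y then 1 else 0 := by
    intro X _ K
    rw [two_mul_numE]
    refine sum_congr rfl fun x _ => ?_
    rw [← card_nb_univ, nb, card_filter]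
  have h := hd (join G H)
  simp only [Fintype.sum_sum_type, join_adj_inl_inl, join_adj_inl_inr, join_adj_inr_inl,
    join_adj_inr_inr, if_true, sum_add_distrib, sum_const, card_univ, smul_eq_mul, mul_one,
    ← hd] at h
  rw [mul_comm (Fintype.card W)] at h
  omega

/-- Isomorphisms of the summands give an isomorphism of the joins. -/
def joinIso {V' W' : Type} {G' : SimpleGraph V'} {H' : SimpleGraph W'} (f : G ≃g G') (g : H ≃g H') :
    join G H ≃g join G' H' where
  toEquiv := Equiv.sumCongr f.toEquiv g.toEquiv
  map_rel_iff' := by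
    rintro (a | a) (b | b)
    · exact join_adj_inl_inl.trans (f.map_adj_iff.trans join_adj_inl_inl.symm)
    · simp
    · simp
    · exact join_adj_inr_inr.trans (g.map_adj_iff.trans join_adj_inr_inr.symm)

end Join

/-- The number of edges of the Turán graph. -/
noncomputable def numT (m p : ℕ) : ℕ := numE (turanGraph m p)

lemma numE_top {V : Type} [Fintype V] :
    numE (⊤ : SimpleGraph V) = (Fintype.card V).choose 2 := by
  rw [← card_edgeFinset_top_eq_card_choose_two, card_edgeFinset_eq_numE]

lemma numH_eq_numE (n p q : ℕ) : numH n p q = numE (graphH n p q) := by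
  rw [numH, card_edgeFinset_eq_numE]

lemma numH_eq (n p k : ℕ) : numH n p (k + 1) = k.choose 2 + numT (n - k) p + k * (n - k) := by
  have h := numE_join (G := completeGraph (Fin k)) (H := turanGraph (n - k) p)
  rw [numE_top, Fintype.card_fin, Fintype.card_fin] at h
  rw [numH_eq_numE, numT, ← h]
  rfl

lemma numT_le (m p : ℕ) (hp : 0 < p) : 2 * (numT m p : ℝ) ≤ (1 - 1 / p) * (m : ℝ) ^ 2 := by
  have h : 2 * p * numT m p ≤ (p - 1) * m ^ 2 := by
    have := mul_card_edgeFinset_turanGraph_le (n := m) (r := p)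
    rwa [card_edgeFinset_eq_numE] at this
  have h' : (2 * p * numT m p : ℝ) ≤ ((p - 1 : ℕ) : ℝ) * (m : ℝ) ^ 2 := by exact_mod_cast h
  rw [Nat.cast_sub (by omega)] at h'
  have hp0 : (0 : ℝ) < p := by exact_mod_cast hp
  have : p * (2 * (numT m p : ℝ)) ≤ p * ((1 - 1 / p) * (m : ℝ) ^ 2) := by
    have h3 : p * ((1 - 1 / p) * (m : ℝ) ^ 2) = (p - 1) * (m : ℝ) ^ 2 := by field_simp
    rw [h3]; push_cast at h'; linarith
  exact le_of_mul_le_mul_left this hp0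

lemma le_numT (m p : ℕ) (hp : 0 < p) :
    (1 - 1 / p) * (m : ℝ) ^ 2 - (p ^ 2 + 2) ≤ 2 * (numT m p : ℝ) := by
  have h : (m ^ 2 - (m % p) ^ 2) * (p - 1) / (2 * p) ≤ numT m p := by
    have := card_edgeFinset_turanGraph (n := m) (r := p)
    rw [card_edgeFinset_eq_numE] at this
    exact (Nat.le_add_right _ _).trans this.ge
  have hlt := Nat.lt_mul_div_succ ((m ^ 2 - (m % p) ^ 2) * (p - 1)) (show 0 < 2 * p by omega)
  have h1 : (m ^ 2 - (m % p) ^ 2) * (p - 1) ≤ 2 * p * (numT m p + 1) :=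
    hlt.le.trans (Nat.mul_le_mul_left _ (by omega))
  have hmod : (m % p) ^ 2 ≤ m ^ 2 := Nat.pow_le_pow_left (Nat.mod_le _ _) 2
  have h2 : (((m : ℝ) ^ 2 - ((m % p : ℕ) : ℝ) ^ 2) * (p - 1) : ℝ) ≤ 2 * p * (numT m p + 1) := by
    have : (((m ^ 2 - (m % p) ^ 2) * (p - 1) : ℕ) : ℝ) ≤ ((2 * p * (numT m p + 1) : ℕ) : ℝ) := by
      exact_mod_cast h1
    rw [Nat.cast_mul, Nat.cast_sub hmod, Nat.cast_sub (by omega)] at this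
    push_cast at this
    exact this
  have hp0 : (0 : ℝ) < p := by exact_mod_cast hp
  have hp1 : (1 : ℝ) ≤ p := by exact_mod_cast hp
  have h3 : ((m % p : ℕ) : ℝ) ^ 2 ≤ (p : ℝ) ^ 2 := by
    have : ((m % p : ℕ) : ℝ) ≤ p := by exact_mod_cast (Nat.mod_lt m hp).le
    gcongr
  have h4 : ((m % p : ℕ) : ℝ) ^ 2 * (p - 1) ≤ (p : ℝ) ^ 2 * (p - 1) :=
    mul_le_mul_of_nonneg_right h3 (by linarith)
  have h5 : (p : ℝ) * ((1 - 1 / p) * (m : ℝ) ^ 2 - (p ^ 2 + 2)) ≤ p * (2 * (numT m p : ℝ)) := by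
    have h6 : (p : ℝ) * ((1 - 1 / p) * (m : ℝ) ^ 2 - (p ^ 2 + 2)) =
      (p - 1) * (m : ℝ) ^ 2 - p * (p ^ 2 + 2) := by field_simp
    rw [h6]
    have : (0 : ℝ) ≤ p ^ 2 := by positivity
    linarith
  exact le_of_mul_le_mul_left h5 hp0

/-- Up to a constant, each of the `k` dominating vertices adds a surplus of `n/p` edges over the
Turán graph on `n` vertices. -/
lemma le_numH (n p k : ℕ) (hp : 0 < p) (hk : k ≤ n) :
    (1 - 1 / p) * (n : ℝ) ^ 2 + 2 * k * (n / p) - (k ^ 2 + k + (p ^ 2 + 2)) ≤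
      2 * (numH n p (k + 1) : ℝ) := by
  rw [numH_eq]
  have h1 := le_numT (n - k) p hp
  rw [Nat.cast_sub hk] at h1
  push_cast
  rw [Nat.cast_choose_two, Nat.cast_sub hk]
  have hp0 : (0 : ℝ) < p := by exact_mod_cast hp
  have hp1 : (1 : ℝ) / p ≤ 1 := by
    rw [div_le_one hp0]; exact_mod_cast hp
  have h2 : (1 - 1 / p) * ((n : ℝ) - k) ^ 2 = (1 - 1 / p) * (n : ℝ) ^ 2 - 2 * k * n +
    2 * k * (n / p) + (1 - 1 / p) * (k : ℝ) ^ 2 := by ring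
  have h3 : 0 ≤ (1 - 1 / p) * (k : ℝ) ^ 2 := mul_nonneg (by linarith) (by positivity)
  linarith

/-- Turns the degree condition of the vertex-deletion argument into the minimum degree needed for
the core. -/
lemma le_numH_sub (n p k : ℕ) (hp : 0 < p) (hk : k < n) :
    (1 - 1 / p) * (n : ℝ) - (p ^ 2 + 3) ≤
      (numH n p (k + 1) : ℝ) - numH (n - 1) p (k + 1) := by
  rw [numH_eq, numH_eq]
  have h1 := le_numT (n - k) p hp
  have h2 := numT_le (n - 1 - k) p hp
  rw [Nat.cast_sub hk.le] at h1
  rw [Nat.cast_sub (by omega), Nat.cast_sub (by omega)] at h2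
  push_cast
  rw [Nat.cast_sub hk.le, Nat.cast_sub (by omega), Nat.cast_sub (by omega)]
  push_cast at h1 h2 ⊢
  have hp0 : (0 : ℝ) < p := by exact_mod_cast hp
  have hp1 : (1 : ℝ) / p ≤ 1 := by
    rw [div_le_one hp0]; exact_mod_cast hp
  have hp2 : (0 : ℝ) ≤ 1 / p := by positivity
  have h3 : (1 - 1 / p) * ((n : ℝ) - k) ^ 2 - (1 - 1 / p) * ((n : ℝ) - 1 - k) ^ 2 =
    2 * ((1 - 1 / p) * n) - (1 - 1 / p) - 2 * k + 2 * (1 / p * k) := by ring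
  have h4 : (0 : ℝ) ≤ 1 / p * k := by positivity
  have h5 : (0 : ℝ) ≤ p ^ 2 := by positivity
  linarith

/-! ### Uniqueness and removal of the degree condition -/

/-- A graph that becomes `p`-colourable after deletion of `k` vertices, with at least as many edges
as `graphH`, is isomorphic to `graphH`. -/
lemma nonempty_iso_graphH {V : Type} [Fintype V] {G : SimpleGraph V} {p k : ℕ} (hp : 0 < p)
    {W : Finset V} (hW : #W = k) {col : V → Fin p}
    (hcol : ∀ x ∉ W, ∀ y ∉ W, G.Adj x y → col x ≠ col y)
    (he : numH (Fintype.card V) p (k + 1) ≤ numE G) :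
    Nonempty (G ≃g graphH (Fintype.card V) p (k + 1)) := by
  let A := {x // x ∈ W}
  let B := {x // x ∉ W}
  have hA : Fintype.card A = k := by rw [← hW]; exact Fintype.card_coe W
  have hB : Fintype.card B = Fintype.card V - k := by
    have := Fintype.card_subtype_compl (fun x => x ∈ W)
    rw [show Fintype.card {x // x ∈ W} = k from hA] at this
    convert this
  let φ : A ⊕ B ≃ V := Equiv.sumCompl (fun x => x ∈ W)
  let G₁ : SimpleGraph B := G.comap Subtype.val
  let G' : SimpleGraph (A ⊕ B) := G.comap φ
  let ψ : G' ≃g G := Iso.comap φ G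
  have hturan : ∀ (K : SimpleGraph B), K.CliqueFree (p + 1) →
      numE K ≤ numT (Fintype.card V - k) p := by
    intro K hK
    have h1 := hK.card_edgeFinset_le
    have h2 := card_edgeFinset_turanGraph (n := Fintype.card B) (r := p)
    rw [card_edgeFinset_eq_numE] at h1 h2
    rw [numT, ← hB, h2]
    exact h1
  have hfree : G₁.CliqueFree (p + 1) := by
    have : G₁.Colorable p := ⟨Coloring.mk (fun x => col x.1) fun {x y} hxy =>
      hcol x.1 x.2 y.1 y.2 hxy⟩
    exact this.cliqueFree (by omega)
  have hle : G' ≤ join (⊤ : SimpleGraph A) G₁ := by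
    rintro (a | a) (b | b) hab
    · rw [join_adj_inl_inl, top_adj]
      exact fun h => hab.ne (by rw [h])
    · exact join_adj_inl_inr
    · exact join_adj_inr_inl
    · exact join_adj_inr_inr.2 hab
  have h1 : numE (join (⊤ : SimpleGraph A) G₁) =
      k.choose 2 + numE G₁ + k * (Fintype.card V - k) := by
    rw [numE_join, numE_top, hA, hB]
  have h2 : numE G' = numE G := numE_congr ψ
  have h3 := card_le_card (edgeFinset_subset_edgeFinset.2 hle)
  rw [card_edgeFinset_eq_numE, card_edgeFinset_eq_numE] at h3
  have h4 := hturan G₁ hfree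
  rw [numH_eq] at he
  -- The edge bound leaves no slack: `W` must be complete and joined to everything, and `G₁` must
  -- attain the Turán number.
  have heq : G' = join (⊤ : SimpleGraph A) G₁ :=
    edgeFinset_inj.1 (eq_of_subset_of_card_le (edgeFinset_subset_edgeFinset.2 hle) (by
      rw [card_edgeFinset_eq_numE, card_edgeFinset_eq_numE]; omega))
  have hmax : G₁.IsTuranMaximal p := by
    refine ⟨hfree, fun K _ hK => ?_⟩
    have h5 := hturan K hK
    rw [card_edgeFinset_eq_numE, card_edgeFinset_eq_numE]
    omega
  have hiso := (isTuranMaximal_iff_nonempty_iso_turanGraph hp).1 hmax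
  rw [hB] at hiso
  obtain ⟨χ⟩ := hiso
  have hAF : Nonempty ((⊤ : SimpleGraph A) ≃g completeGraph (Fin k)) :=
    ⟨Iso.completeGraph (Fintype.equivFinOfCardEq hA)⟩
  obtain ⟨ω⟩ := hAF
  have ψ' : join (⊤ : SimpleGraph A) G₁ ≃g G := heq ▸ ψ
  exact ⟨ψ'.symm.trans (joinIso ω χ)⟩

lemma numE_eq_numE_induce_add_degree {V : Type} [Fintype V] (G : SimpleGraph V) (v : V) :
    numE G = numE (G.induce {v}ᶜ) + G.degree v := by
  have h1 := G.card_edgeFinset_induce_compl_singleton v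
  have h2 := G.card_edgeFinset_deleteIncidenceSet v
  have h3 := G.degree_le_card_edgeFinset v
  rw [h2, card_edgeFinset_eq_numE, card_edgeFinset_eq_numE] at h1
  rw [card_edgeFinset_eq_numE] at h3
  omega

lemma numE_le_sq {V : Type} [Fintype V] (G : SimpleGraph V) : numE G ≤ Fintype.card V ^ 2 := by
  have h1 := G.card_edgeFinset_le_card_choose_two
  rw [card_edgeFinset_eq_numE] at h1
  exact h1.trans (Nat.choose_le_pow _ _)

/-- Deleting vertices of small degree: if a graph with at least `h n` edges and minimum degree at
least `h n - h (n - 1)` has exactly `h n` edges, then the same holds for large `n` without the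
degree condition. -/
lemma exists_forall_degree_of_induction {U : Type} (F : SimpleGraph U) (h : ℕ → ℕ) (N₀ : ℕ)
    (hF : ∀ (V : Type) [Fintype V] (G : SimpleGraph V), N₀ ≤ Fintype.card V → F.Free G →
      h (Fintype.card V) ≤ numE G →
      (∀ v, h (Fintype.card V) ≤ G.degree v + h (Fintype.card V - 1)) →
      numE G = h (Fintype.card V)) :
    ∃ N : ℕ, ∀ (V : Type) [Fintype V] (G : SimpleGraph V), N ≤ Fintype.card V → F.Free G →
      h (Fintype.card V) ≤ numE G →
      ∀ v, h (Fintype.card V) ≤ G.degree v + h (Fintype.card V - 1) := by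
  have hcardv : ∀ (V : Type) [Fintype V] (v : V),
      Fintype.card ({v}ᶜ : Set V) = Fintype.card V - 1 := by
    intro V _ v
    rw [Fintype.card_compl_set]; simp
  -- A graph with positive excess over `h` has a vertex violating the degree condition, and deleting
  -- it raises the excess by at least one. Down at `N₀` vertices the excess is at most `N₀ ^ 2`, so
  -- positive excess is impossible for large `n`.
  have hbound : ∀ n, N₀ ≤ n → ∀ (V : Type) [Fintype V] (G : SimpleGraph V), Fintype.card V = n →
      F.Free G → h n < numE G → numE G + n ≤ h n + (N₀ ^ 2 + N₀) := by
    intro n hn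
    induction n, hn using Nat.le_induction with
    | base =>
      intro V _ G hV _ _
      have := numE_le_sq G
      rw [hV] at this
      omega
    | succ n hn ih =>
      intro V _ G hV hG hlt
      by_cases hdeg : ∀ v, h (Fintype.card V) ≤ G.degree v + h (Fintype.card V - 1)
      · have := hF V G (by omega) hG (by rw [hV]; exact hlt.le) hdeg
        rw [hV] at this
        omega
      · push Not at hdeg
        obtain ⟨v, hv⟩ := hdeg
        rw [hV, Nat.add_sub_cancel] at hv
        have h1 := numE_eq_numE_induce_add_degree G v
        have h2 := ih _ (G.induce {v}ᶜ) (by rw [hcardv, hV, Nat.add_sub_cancel])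
          (fun hc => hG (hc.trans ⟨Copy.induce G {v}ᶜ⟩)) (by omega)
        omega
  refine ⟨N₀ ^ 2 + N₀ + 2, fun V _ G hn hG hle v => ?_⟩
  by_contra! hv
  have h1 := numE_eq_numE_induce_add_degree G v
  have h2 := hbound (Fintype.card V - 1) (by omega) _ (G.induce {v}ᶜ) (hcardv V v)
    (fun hc => hG (hc.trans ⟨Copy.induce G {v}ᶜ⟩)) (by omega)
  omega

/-- Uniqueness of the extremal graph for edge blow-ups of graphs with a near cover of size `k`. -/
theorem exists_nonempty_iso_graphH {τ : Type} [Fintype τ] {T : SimpleGraph τ} {S : Finset τ}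
    {u₀ v₀ : τ} (hT : NearCover T S u₀ v₀) (hT2 : T.Colorable 2) {p k : ℕ} (hp : 3 ≤ p)
    (hk : #S = k) :
    ∃ N : ℕ, ∀ (V : Type) [Fintype V] (G : SimpleGraph V), N ≤ Fintype.card V →
      (edgeBlowup T (p + 1)).Free G → numH (Fintype.card V) p (k + 1) ≤ numE G →
      Nonempty (G ≃g graphH (Fintype.card V) p (k + 1)) := by
  have hC : (0 : ℝ) ≤ k ^ 2 + k + (p ^ 2 + 3) := by positivity
  obtain ⟨N₁, hN₁⟩ := exists_partition hT hT2 hp hC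
  have hiso : ∀ (V : Type) [Fintype V] (G : SimpleGraph V), max N₁ (k + 1) ≤ Fintype.card V →
      (edgeBlowup T (p + 1)).Free G → numH (Fintype.card V) p (k + 1) ≤ numE G →
      (∀ v, numH (Fintype.card V) p (k + 1) ≤
        G.degree v + numH (Fintype.card V - 1) p (k + 1)) →
      Nonempty (G ≃g graphH (Fintype.card V) p (k + 1)) := by
    intro V _ G hn hfree he hdeg
    have hkn : k < Fintype.card V := by omega
    obtain ⟨W, hW, col, hcol⟩ := hN₁ V G (by omega) (fun v => by
      have h1 := le_numH_sub (Fintype.card V) p k (by omega) hkn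
      have h2 : (numH (Fintype.card V) p (k + 1) : ℝ) ≤
        G.degree v + numH (Fintype.card V - 1) p (k + 1) := by exact_mod_cast hdeg v
      have h3 : (0 : ℝ) ≤ (k : ℝ) ^ 2 + k := by positivity
      linarith) hfree (by
      have h1 := le_numH (Fintype.card V) p k (by omega) hkn.le
      have h2 : (2 * numE G : ℝ) = ∑ v, (G.degree v : ℝ) := by exact_mod_cast two_mul_numE G
      have h3 : (numH (Fintype.card V) p (k + 1) : ℝ) ≤ numE G := by exact_mod_cast he
      rw [hk]
      linarith)
    exact nonempty_iso_graphH (by omega) (hW.trans hk) hcol he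
  obtain ⟨N, hN⟩ := exists_forall_degree_of_induction (edgeBlowup T (p + 1))
    (fun n => numH n p (k + 1)) (max N₁ (k + 1)) (fun V _ G hn hfree he hdeg => by
      obtain ⟨f⟩ := hiso V G hn hfree he hdeg
      rw [numH_eq_numE, numE_congr f])
  exact ⟨max N (max N₁ (k + 1)), fun V _ G hn hfree he =>
    hiso V G (by omega) hfree he (hN V G (by omega) hfree he)⟩

/-! ### Freeness of `graphH` -/

/-- `K_k + T(n - k, p)` contains no `k + 1` disjoint cliques of size `p + 1`, hence no edge blow-up
of a graph with `k + 1` disjoint edges. -/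
lemma edgeBlowup_free_graphH {τ : Type} {T : SimpleGraph τ} {p k : ℕ} (hp : 0 < p) (n : ℕ)
    (a b : Fin (k + 1) → τ) (hab : ∀ i, T.Adj (a i) (b i))
    (hdisj : ∀ i j, i ≠ j → a i ≠ a j ∧ a i ≠ b j ∧ b i ≠ b j) :
    (edgeBlowup T (p + 1)).Free (graphH n p (k + 1)) := by
  rintro ⟨f⟩
  let e : Fin (k + 1) → T.edgeSet := fun i => ⟨s(a i, b i), hab i⟩
  have hmeet : ∀ i, ∃ x ∈ edgeClique T (p + 1) (e i), ∃ c : Fin k, f x = Sum.inl c := by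
    intro i
    by_contra! hcon
    -- Enumerates the `p + 1` vertices of the clique. If all landed in the Turán part, two would
    -- agree modulo `p` and be non-adjacent.
    let g : Option (Option (Fin (p + 1 - 2))) → τ ⊕ T.edgeSet × Fin (p + 1 - 2) := fun o =>
      o.elim (Sum.inl (a i)) fun o => o.elim (Sum.inl (b i)) fun j => Sum.inr (e i, j)
    have hgmem : ∀ o, g o ∈ edgeClique T (p + 1) (e i) := by
      rintro (_ | _ | j)
      · exact inl_mem_edgeClique.2 (by simp [e])
      · exact inl_mem_edgeClique.2 (by simp [e])
      · exact inr_mem_edgeClique.2 rfl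
    have hginj : Function.Injective g := by
      rintro (_ | _ | j) (_ | _ | l) h
      · rfl
      · exact absurd (Sum.inl_injective h) (hab i).ne
      · exact absurd h (by simp [g])
      · exact absurd (Sum.inl_injective h) (hab i).ne'
      · rfl
      · exact absurd h (by simp [g])
      · exact absurd h (by simp [g])
      · exact absurd h (by simp [g])
      · have : j = l := by simpa [g] using h
        rw [this]
    have hright : ∀ o, ∃ y : Fin (n - k), f (g o) = Sum.inr y := by
      intro o
      rcases h : f (g o) with c | y
      · exact absurd h (hcon _ (hgmem o) c)
      · exact ⟨y, rfl⟩
    choose y hy using hright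
    obtain ⟨o, o', hne, heq⟩ := Fintype.exists_ne_map_eq_of_card_lt
      (fun o => (⟨(y o).1 % p, Nat.mod_lt _ hp⟩ : Fin p)) (by simp; omega)
    have hadj : (edgeBlowup T (p + 1)).Adj (g o) (g o') :=
      edgeBlowup_adj.2 ⟨hginj.ne hne, e i, hgmem o, hgmem o'⟩
    have hadj' := f.toHom.map_adj hadj
    rw [Copy.toHom_apply, Copy.toHom_apply, hy, hy] at hadj'
    have h1 : (turanGraph (n - k) p).Adj (y o) (y o') := join_adj_inr_inr.1 hadj'
    rw [turanGraph_adj] at h1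
    exact h1 (by simpa using heq)
  choose x hx c hc using hmeet
  -- Disjoint edges have disjoint cliques, so the `k + 1` cliques would use distinct vertices among
  -- only `k`.
  have hinj : Function.Injective c := by
    intro i j hij
    have h1 : x i = x j := f.injective (by
      rw [Copy.coe_toHom, hc, hc, hij])
    by_contra hne
    have hij' := hdisj i j hne
    have hji' := hdisj j i (Ne.symm hne)
    have hxi := hx i
    have hxj := hx j
    rw [← h1] at hxj
    rcases h : x i with w | ⟨e', l⟩
    · rw [h, inl_mem_edgeClique] at hxi hxj
      rcases Sym2.mem_iff.1 hxi with rfl | rfl <;> rcases Sym2.mem_iff.1 hxj with h2 | h2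
      exacts [hij'.1 h2, hij'.2.1 h2, hji'.2.1 h2.symm, hij'.2.2 h2]
    · rw [h, inr_mem_edgeClique] at hxi hxj
      have h2 : s(a i, b i) = s(a j, b j) := congrArg Subtype.val (hxi.symm.trans hxj)
      rcases Sym2.eq_iff.1 h2 with h3 | h3
      exacts [hij'.1 h3.1, hij'.2.1 h3.1]
  have := Fintype.card_le_of_injective c hinj
  simp at this

/-! ### The double broom -/

section DoubleBroom

variable {ℓ s t : ℕ}

lemma doubleBroom_adj_inl_inl {i j : Fin ℓ} :
    (doubleBroom ℓ s t).Adj (.inl i) (.inl j) ↔ i.1 + 1 = j.1 ∨ j.1 + 1 = i.1 := by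
  simp only [doubleBroom, fromRel_adj, pathGraph_adj, ne_eq, Sum.inl.injEq, Fin.ext_iff]
  omega

lemma doubleBroom_adj_inl_inr_inl {i : Fin ℓ} {x : Fin s} :
    (doubleBroom ℓ s t).Adj (.inl i) (.inr (.inl x)) ↔ i.1 = 0 := by
  simp [doubleBroom]

lemma doubleBroom_adj_inl_inr_inr {i : Fin ℓ} {x : Fin t} :
    (doubleBroom ℓ s t).Adj (.inl i) (.inr (.inr x)) ↔ i.1 + 1 = ℓ := by
  simp [doubleBroom]

lemma not_doubleBroom_adj_inr_inr {x y : Fin s ⊕ Fin t} :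
    ¬ (doubleBroom ℓ s t).Adj (.inr x) (.inr y) := by
  simp [doubleBroom]

lemma doubleBroom_colorable_two (k s t : ℕ) :
    (doubleBroom (2 * k) s t).Colorable 2 := by
  let c : Fin (2 * k) ⊕ (Fin s ⊕ Fin t) → Fin 2 := Sum.elim (fun i => ⟨i.1 % 2, by omega⟩)
    (Sum.elim (fun _ => 1) fun _ => 0)
  have hc : ∀ x y, (doubleBroom (2 * k) s t).Adj (.inl x) y → c (.inl x) ≠ c y := by
    rintro i (j | x | x) hij
    · rw [doubleBroom_adj_inl_inl] at hij
      simp only [c, Sum.elim_inl, ne_eq, Fin.ext_iff]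
      omega
    · rw [doubleBroom_adj_inl_inr_inl] at hij
      simp [c, hij]
    · rw [doubleBroom_adj_inl_inr_inr] at hij
      simp only [c, Sum.elim_inl, Sum.elim_inr, ne_eq, Fin.ext_iff, Fin.val_zero]
      omega
  refine ⟨Coloring.mk c ?_⟩
  rintro (i | x) y hxy
  · exact hc i y hxy
  · rcases y with j | y
    · exact (hc j _ hxy.symm).symm
    · exact absurd hxy not_doubleBroom_adj_inr_inr

/-- The near cover `0, 2, …, 2k - 4, 2k - 1` of the double broom. -/
def broomCover (k s t : ℕ) : Finset (Fin (2 * k) ⊕ (Fin s ⊕ Fin t)) :=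
  (univ : Finset (Fin k)).image fun j =>
    .inl ⟨if j.1 + 1 < k then 2 * j.1 else 2 * k - 1, by split_ifs <;> omega⟩

lemma card_broomCover (k s t : ℕ) : #(broomCover k s t) = k := by
  rw [broomCover, card_image_of_injective, card_univ, Fintype.card_fin]
  intro a b h
  simp only [Sum.inl.injEq, Fin.mk.injEq] at h
  ext
  split_ifs at h <;> omega

lemma inl_mem_broomCover {k s t : ℕ} {i : Fin (2 * k)} :
    Sum.inl i ∈ broomCover k s t ↔ (i.1 % 2 = 0 ∧ i.1 + 4 ≤ 2 * k) ∨ i.1 + 1 = 2 * k := by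
  simp only [broomCover, mem_image, mem_univ, true_and, Sum.inl.injEq, Fin.ext_iff]
  constructor
  · rintro ⟨j, hj⟩
    split_ifs at hj <;> omega
  · rintro (h | h)
    · exact ⟨⟨i.1 / 2, by omega⟩, by rw [if_pos (by dsimp only; omega)]; dsimp only; omega⟩
    · exact ⟨⟨k - 1, by omega⟩, by rw [if_neg (by dsimp only; omega)]; omega⟩

lemma inr_notMem_broomCover {k s t : ℕ} {x : Fin s ⊕ Fin t} :
    Sum.inr x ∉ broomCover k s t := by simp [broomCover]

/-- Both path ends must be in the cover to meet the pendant edges. As they have opposite parity, the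
alternating pattern breaks once; placing the break just before the last vertex leaves only the edge
between `2k - 3` and `2k - 2` uncovered. -/
lemma nearCover_broomCover (k s t : ℕ) (hk : 2 ≤ k) :
    NearCover (doubleBroom (2 * k) s t) (broomCover k s t) (.inl ⟨2 * k - 3, by omega⟩)
      (.inl ⟨2 * k - 2, by omega⟩) := by
  have h0 : (Sum.inl ⟨0, by omega⟩ : Fin (2 * k) ⊕ (Fin s ⊕ Fin t)) ∈ broomCover k s t :=
    inl_mem_broomCover.2 (Or.inl ⟨by simp, by simp; omega⟩)
  have h1 : (Sum.inl ⟨2 * k - 1, by omega⟩ : Fin (2 * k) ⊕ (Fin s ⊕ Fin t)) ∈ broomCover k s t :=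
    inl_mem_broomCover.2 (Or.inr (by dsimp only; omega))
  refine ⟨?_, ?_, ?_, ?_, ?_, ?_⟩
  · rw [doubleBroom_adj_inl_inl]; dsimp only; omega
  · rintro (i | x) hi (j | y) hj hij
    · rw [inl_mem_broomCover] at hi hj
      rw [doubleBroom_adj_inl_inl] at hij
      omega
    · exact inr_notMem_broomCover hj
    · exact inr_notMem_broomCover hi
    · exact inr_notMem_broomCover hi
  · rintro (i | x) (j | y) hij hi hj
    · rw [inl_mem_broomCover] at hi hj
      rw [doubleBroom_adj_inl_inl] at hij
      rw [Sym2.eq_iff]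
      simp only [Sum.inl.injEq, Fin.ext_iff]
      omega
    · rw [inl_mem_broomCover] at hi
      rcases y with y | y
      · rw [doubleBroom_adj_inl_inr_inl] at hij; omega
      · rw [doubleBroom_adj_inl_inr_inr] at hij; omega
    · rw [inl_mem_broomCover] at hj
      rcases x with x | x
      · rw [SimpleGraph.adj_comm, doubleBroom_adj_inl_inr_inl] at hij; omega
      · rw [SimpleGraph.adj_comm, doubleBroom_adj_inl_inr_inr] at hij; omega
    · exact absurd hij not_doubleBroom_adj_inr_inr
  · rintro (i | x | x) hi
    · rw [inl_mem_broomCover] at hi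
      by_cases hlast : i.1 + 3 < 2 * k
      · refine ⟨.inl ⟨i.1 - 1, by omega⟩, inl_mem_broomCover.2 (by dsimp only; omega),
          .inl ⟨i.1 + 1, by omega⟩, inl_mem_broomCover.2 (by dsimp only; omega), ?_⟩
        rintro (j | y) hj hij
        · rw [doubleBroom_adj_inl_inl] at hij
          simp only [Sum.inl.injEq, Fin.ext_iff]
          omega
        · exact absurd hj inr_notMem_broomCover
      · refine ⟨.inl ⟨2 * k - 4, by omega⟩, inl_mem_broomCover.2 (by dsimp only; omega),
          .inl ⟨2 * k - 1, by omega⟩, h1, ?_⟩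
        rintro (j | y) hj hij
        · rw [doubleBroom_adj_inl_inl] at hij
          rw [inl_mem_broomCover] at hj
          simp only [Sum.inl.injEq, Fin.ext_iff]
          omega
        · exact absurd hj inr_notMem_broomCover
    · refine ⟨_, h0, _, h0, ?_⟩
      rintro (j | y) hj hij
      · rw [doubleBroom_adj_inl_inr_inl] at hij
        simp only [Sum.inl.injEq, Fin.ext_iff]
        omega
      · exact absurd hj inr_notMem_broomCover
    · refine ⟨_, h1, _, h1, ?_⟩
      rintro (j | y) hj hij
      · rw [doubleBroom_adj_inl_inr_inr] at hij
        simp only [Sum.inl.injEq, Fin.ext_iff]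
        omega
      · exact absurd hj inr_notMem_broomCover
  · refine ⟨.inl ⟨2 * k - 4, by omega⟩, inl_mem_broomCover.2 (by dsimp only; omega), ?_⟩
    rintro (j | y) hj hij
    · rw [doubleBroom_adj_inl_inl] at hij
      rw [inl_mem_broomCover] at hj
      simp only [Sum.inl.injEq, Fin.ext_iff]
      dsimp only at hij
      omega
    · exact absurd hj inr_notMem_broomCover
  · refine ⟨_, h1, ?_⟩
    rintro (j | y) hj hij
    · rw [doubleBroom_adj_inl_inl] at hij
      rw [inl_mem_broomCover] at hj
      simp only [Sum.inl.injEq, Fin.ext_iff]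
      dsimp only at hij
      omega
    · exact absurd hj inr_notMem_broomCover

/-- The `k + 1` disjoint edges are one pendant edge at each end of the path and the path edges from
`2i - 1` to `2i` for `0 < i < k`. -/
lemma edgeBlowup_doubleBroom_free_graphH {p k s t : ℕ} (hp : 0 < p) (hk : 1 ≤ k) (hs : 0 < s)
    (ht : 0 < t) (n : ℕ) :
    (edgeBlowup (doubleBroom (2 * k) s t) (p + 1)).Free (graphH n p (k + 1)) := by
  let b : Fin (k + 1) → Fin (2 * k) ⊕ (Fin s ⊕ Fin t) := fun i =>
    if i.1 = 0 then .inr (.inl ⟨0, hs⟩) else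
      if h : i.1 < k then .inl ⟨2 * i.1, by omega⟩ else .inr (.inr ⟨0, ht⟩)
  -- Truncated subtraction makes this vertex `0` at `i = 0`, the end that carries the first pendant
  -- edge.
  refine edgeBlowup_free_graphH hp n (fun i => .inl ⟨2 * i.1 - 1, by omega⟩) b ?_ ?_
  · intro i
    simp only [b]
    split_ifs with h1 h2
    · rw [doubleBroom_adj_inl_inr_inl]; dsimp only; omega
    · rw [doubleBroom_adj_inl_inl]; dsimp only; omega
    · rw [doubleBroom_adj_inl_inr_inr]; dsimp only; omega
  · intro i j hij
    have hij' : i.1 ≠ j.1 := fun h => hij (Fin.ext h)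
    refine ⟨?_, ?_, ?_⟩
    · simp only [ne_eq, Sum.inl.injEq, Fin.mk.injEq]; omega
    · simp only [b]
      split_ifs with h1 h2
      · simp
      · simp only [ne_eq, Sum.inl.injEq, Fin.mk.injEq]; omega
      · simp
    · simp only [b]
      split_ifs <;> simp <;> omega

end DoubleBroom

end EdgeBlowup

/-! ### The extremal number and the unique extremal graph -/

open SimpleGraph Finset EdgeBlowup

theorem corollary1p5 (p k s t : ℕ) (hp : 3 ≤ p) (hk : 2 ≤ k) (hs : 2 ≤ s) (ht : 2 ≤ t) :
    ∃ N : ℕ, ∀ n : ℕ, N ≤ n →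
      SimpleGraph.extremalNumber n
          (EdgeBlowup.edgeBlowup (EdgeBlowup.doubleBroom (2 * k) s t) (p + 1)) =
        EdgeBlowup.numH n p (k + 1) ∧
      ∀ (G : SimpleGraph (Fin n)) [DecidableRel G.Adj],
        G.IsExtremal
            (EdgeBlowup.edgeBlowup (EdgeBlowup.doubleBroom (2 * k) s t) (p + 1)).Free ↔
          Nonempty (G ≃g EdgeBlowup.graphH n p (k + 1)) := by
  classical
  obtain ⟨N, hN⟩ := exists_nonempty_iso_graphH (nearCover_broomCover k s t hk)
    (doubleBroom_colorable_two k s t) hp (card_broomCover k s t)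
  have hfreeH := edgeBlowup_doubleBroom_free_graphH (p := p) (k := k) (s := s) (t := t)
    (by omega) (by omega) (by omega) (by omega)
  generalize edgeBlowup (doubleBroom (2 * k) s t) (p + 1) = F at hN hfreeH ⊢
  -- The bound `k ≤ n` ensures that `graphH n p (k + 1)` has exactly `n` vertices.
  refine ⟨max N k, fun n hn => ?_⟩
  have hiso : ∀ G : SimpleGraph (Fin n), F.Free G → numH n p (k + 1) ≤ numE G →
      Nonempty (G ≃g graphH n p (k + 1)) := by
    have := hN (Fin n)
    rw [Fintype.card_fin] at this
    exact fun G => this G (by omega)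
  have hex : extremalNumber n F = numH n p (k + 1) := by
    apply le_antisymm
    · have h : extremalNumber (Fintype.card (Fin n)) F ≤ numH n p (k + 1) := by
        rw [extremalNumber_le_iff]
        intro G _ hG
        rw [card_edgeFinset_eq_numE]
        by_contra! hlt
        obtain ⟨f⟩ := hiso G hG hlt.le
        rw [numH_eq_numE, numE_congr f] at hlt
        exact lt_irrefl _ hlt
      rwa [Fintype.card_fin] at h
    · have h := card_edgeFinset_le_extremalNumber (hfreeH n)
      rw [card_edgeFinset_eq_numE, ← numH_eq_numE] at h
      have hcard : Fintype.card (Fin (k + 1 - 1) ⊕ Fin (n - (k + 1 - 1))) = n := by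
        simp; omega
      rwa [hcard] at h
  refine ⟨hex, fun G _ => ?_⟩
  rw [isExtremal_free_iff, card_edgeFinset_eq_numE, Fintype.card_fin, hex]
  constructor
  · exact fun h => hiso G h.1 h.2.ge
  · rintro ⟨f⟩
    exact ⟨(free_congr_right f).2 (hfreeH n), by rw [numH_eq_numE, numE_congr f]⟩
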